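/- **Setting.** Let $N\ge 0$, $T>0$. Points of $\mathbb R^N\times\mathbb R$ are written $(b,l)$ (velocity, running cost). *(BL)* $\mathbf{BL}$ maps each $(x,t)\in\mathbb R^N\times[0,T]$ to a nonempty compact convex subset of $\mathbb R^N\times\mathbb R$, is upper semicontinuous as a set-valued map on $\mathbb R^N\times[0,T]$, and there is $M>0$ with $|b|\le M$, $|l|\le M$ for all $(b,l)\in\mathbf{BL}(x,t)$, $x\in\mathbb R^N$, $t\in(0,T]$. Put $\mathbf B(x,t)=\{b:\ (b,l)\in\mathbf{BL}(x,t)\text{ for some }l\}$. *Value function.* Let $g:\mathbb R^N\to\mathbb R$ be bounded and uniformly continuous. For $(x,t)\in\mathbb R^N\times[0,T]$ let $\mathcal T(x,t)$ be the set of Lipschitz $(X,L):[0,t]\to\mathbb R^N\times\mathbb R$ with $(X,L)(0)=(x,0)$ and $(\dot X,\dot L)(s)\in\mathbf{BL}(X(s),t-s)$ for a.e. $s\in(0,t)$, and $$U(x,t)=\inf_{(X,L)\in\mathcal T(x,t)}\Big\{\int_0^t \dot L(s)\,ds+g(X(t))\Big\}.$$ *Admissible flat stratification.* Disjoint sets $A^0,\dots,A^N$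 with union an open set $\Omega\subset\mathbb R^N$ form an admissible flat stratification of $\Omega$ if: (i) for every $y\in A^k$ there are $r>0$ and a $k$-dimensional linear subspace $V$ with $B(y,r)\subset\Omega$, $B(y,r)\cap A^k=B(y,r)\cap(y+V)$ and $B(y,r)\cap A^l=\emptyset$ for $l<k$ (we say that $(r,V)$ is *flat* at $y$); (ii) if $k<l$ and a connected component of $A^k$ meets $\overline{A^l}$, then it is contained in $\overline{A^l}$; (iii) $\overline{A^k}\cap\Omega\subset A^0\cup\dots\cup A^k$. *Regular stratification.* $\mathbb R^N$ is the disjoint union of sets $\mathbf M^0,\dots,\mathbf M^N$, and for each $x\in\mathbb R^N$ there is given a change of coordinates $\Psi^x:B(x,r(x))\to\Omega_x$ onto an open set, a $C^1$-diffeomorphism such that its derivative and that of its inverse $\chi=(\Psi^x)^{-1}$ are locally Lipschitz, such that the sets $\tilde{\mathbf M}^k:=\Psi^x(\mathbf M^k\cap B(x,r(x)))$ form an admissible flat stratification of $\Omega_x$. In these coordinates put $\widetilde{\mathbf{BL}}(y,t)=\{(D\Psi^x(\chi(y))b,\,l):(b,l)\in\mathbf{BL}(\chi(y),t)\}$ and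 let $\tilde{\mathbf B}(y,t)$ be its set of velocities. The conditions below are local: they are imposed around each point $x$, and $r,\delta,C$ and the modulus may depend on $x$. *(TC-BL)* For every $k\le N$ and $x\in\mathbf M^k$ there are $(r,V)$ flat at $\Psi^x(x)$ for $(\tilde{\mathbf M}^j)_j$, a constant $C$, and $m:[0,\infty)\to[0,\infty)$ with $m(0+)=0$, such that for all $j\ge k$, all $y_1,y_2\in\tilde{\mathbf M}^j\cap B(\Psi^x(x),r)$ with $y_1-y_2\in V$, and all $t,t'\in[0,T]$, $$d_H(\tilde{\mathbf B}(y_1,t),\tilde{\mathbf B}(y_2,t))\le C|y_1-y_2|,\qquad d_H(\widetilde{\mathbf{BL}}(y_1,t),\widetilde{\mathbf{BL}}(y_2,t'))\le m(|y_1-y_2|+|t-t'|),$$ where $d_H$ is the Hausdorff distance. *(NC-BL)* For every $k<N$ and $x\in\mathbf M^k$ there are $(r,V)$ flat at $\Psi^x(x)$ for $(\tilde{\mathbf M}^j)_j$ and $\delta>0$ such that for all $t\in[0,T]$ and $y\in B(\Psi^x(x),r)\setminus\tilde{\mathbf M}^k$, $$B(0,\delta)\cap V^\perp\subset\tilde{\mathbf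 B}(y,t)\cap V^\perp .$$ *Notation.* For $x\in\mathbf M^k$ let $T_x\mathbf M^k$ be the tangent space and $H^k(x,t,p)=\sup\{-b\cdot p-l:\ (b,l)\in\mathbf{BL}(x,t),\ b\in T_x\mathbf M^k\}$. For $D\subset\mathbb R^N\times[0,T]$ and $z\in D$ put $(U|_D)^*(z)=\limsup_{D\ni z'\to z}U(z')$; write $U^*$ for $D=\mathbb R^N\times[0,T]$ and $(U|_{\mathbf M^k})^*$ for $D=\mathbf M^k\times[0,T]$. **Theorem 4.1 (Subsolution's property).** Under (BL), (TC-BL) and (NC-BL), for every $k=0,\dots,N-1$: (i) $U^*=(U|_{\mathbf M^k})^*$ on $\mathbf M^k\times[0,T]$; (ii) $U$ is locally bounded and is a viscosity subsolution of $U_t+H^k(x,t,DU)=0$ on $\mathbf M^k\times(0,T)$, as an equation restricted to $\mathbf M^k$: if $(x,t)\in\mathbf M^k\times(0,T)$, $\phi$ is a real function of class $C^1$ in a neighbourhood of $(x,t)$ in $\mathbb R^N\times(0,T)$, and $(x,t)$ is a local maximum point of $U^*-\phi$ on $\mathbf M^k\times(0,T)$, then $$\phi_t(x,t)+H^k(x,t,D\phi(x,t))\le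 0 .$$ -/

import Mathlib

open Set Filter Topology MeasureTheory

noncomputable section

namespace StratifiedControl

/-- The Euclidean space `ℝ^N`. -/
abbrev E (N : ℕ) := EuclideanSpace ℝ (Fin N)

/-! ## Set-valued dynamics and costs, trajectories, value function

Space-time points are pairs `(x, t)`; elements of `BL (x, t)` are pairs `(b, l)` of a velocity and
a running cost. Only the values of `BL` on `ℝ^N × [0, T]` matter. -/

/-- The basic assumption on the set-valued map: nonempty compact convex images, upper
semicontinuity on `ℝ^N × [0, T]`, and a uniform bound on dynamics and costs. -/
structure IsBL {N : ℕ} (T : ℝ) (BL : E N × ℝ → Set (E N × ℝ)) : Prop where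
  nonempty : ∀ x, ∀ t ∈ Icc 0 T, (BL (x, t)).Nonempty
  isCompact : ∀ x, ∀ t ∈ Icc 0 T, IsCompact (BL (x, t))
  convex : ∀ x, ∀ t ∈ Icc 0 T, Convex ℝ (BL (x, t))
  usc : UpperHemicontinuousOn BL (univ ×ˢ Icc 0 T)
  bounded : ∃ M > 0, ∀ x, ∀ t ∈ Ioc 0 T, ∀ b l, (b, l) ∈ BL (x, t) → ‖b‖ ≤ M ∧ |l| ≤ M

/-- `(X, L)` is a Lipschitz solution on `[0, t]` of `(X, L)'(s) ∈ BL (X s, t - s)` for almost every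
`s`, with `(X, L)(0) = (x, 0)`. -/
structure IsTrajectory {N : ℕ} (BL : E N × ℝ → Set (E N × ℝ)) (x : E N) (t : ℝ)
    (X : ℝ → E N) (L : ℝ → ℝ) : Prop where
  lipschitz_X : ∃ K, LipschitzOnWith K X (Icc 0 t)
  lipschitz_L : ∃ K, LipschitzOnWith K L (Icc 0 t)
  start_X : X 0 = x
  start_L : L 0 = 0
  inclusion : ∀ᵐ s ∂(volume.restrict (Ioo 0 t)),
    ∃ b l, (b, l) ∈ BL (X s, t - s) ∧ HasDerivAt X b s ∧ HasDerivAt L l s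

/-- The value function: the infimum over all trajectories from `(x, t)` of the accumulated running
cost `∫₀ᵗ l ds`, with `l = L'`, plus the final cost `g (X t)`. -/
def value {N : ℕ} (BL : E N × ℝ → Set (E N × ℝ)) (g : E N → ℝ) (z : E N × ℝ) : ℝ :=
  sInf {c | ∃ X L, IsTrajectory BL z.1 z.2 X L ∧
    c = (∫ s in (0 : ℝ)..z.2, deriv L s) + g (X z.2)}

/-! ## Stratifications -/

/-- In the ball `B(y, r) ⊆ Ω`, the set `A k` coincides with the affine space `y + V`,
`dim V = k`, and no set `A l` with `l < k` meets the ball. -/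
structure IsFlatAt {N : ℕ} (Ω : Set (E N)) (A : Fin (N + 1) → Set (E N)) (k : Fin (N + 1))
    (y : E N) (r : ℝ) (V : Submodule ℝ (E N)) : Prop where
  pos : 0 < r
  ball_subset : Metric.ball y r ⊆ Ω
  finrank_eq : Module.finrank ℝ V = k
  inter_eq : Metric.ball y r ∩ A k = Metric.ball y r ∩ {z | z - y ∈ V}
  inter_lower : ∀ l < k, Metric.ball y r ∩ A l = ∅

/-- `(A k)` is an admissible flat stratification of the open set `Ω`. The frontier condition is
imposed on each connected component of `A k`; in particular it holds if
`A k ⊆ closure (A l)` as soon as `A k ∩ closure (A l) ≠ ∅`. -/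
structure IsAFS {N : ℕ} (Ω : Set (E N)) (A : Fin (N + 1) → Set (E N)) : Prop where
  iUnion_eq : ⋃ k, A k = Ω
  disjoint : Pairwise fun k l => Disjoint (A k) (A l)
  flat : ∀ k, ∀ y ∈ A k, ∃ r V, IsFlatAt Ω A k y r V
  frontier_condition : ∀ k l, k < l → ∀ y ∈ A k ∩ closure (A l),
    connectedComponentIn (A k) y ⊆ closure (A l)
  closure_subset : ∀ k, closure (A k) ∩ Ω ⊆ ⋃ l ≤ k, A l

/-- A regular stratification `(M, Ψ)` of `ℝ^N`: disjoint sets `M k` covering `ℝ^N` and, around each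
point `x`, a `C^{1,1}` change of coordinates `Ψ x`, defined on a ball centred at `x`, which
straightens the `M k` into an admissible flat stratification of the image of this ball. -/
structure RegularStratification (N : ℕ) where
  M : Fin (N + 1) → Set (E N)
  iUnion_eq : ⋃ k, M k = univ
  disjoint : Pairwise fun k l => Disjoint (M k) (M l)
  Ψ : E N → OpenPartialHomeomorph (E N) (E N)
  radius : E N → ℝ
  radius_pos : ∀ x, 0 < radius x
  source_eq : ∀ x, (Ψ x).source = Metric.ball x (radius x)
  contDiffOn : ∀ x, ContDiffOn ℝ 1 (Ψ x) (Ψ x).source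
  contDiffOn_symm : ∀ x, ContDiffOn ℝ 1 (Ψ x).symm (Ψ x).target
  lipschitz_fderiv : ∀ x, LocallyLipschitzOn (Ψ x).source (fderiv ℝ (Ψ x))
  lipschitz_fderiv_symm : ∀ x, LocallyLipschitzOn (Ψ x).target (fderiv ℝ (Ψ x).symm)
  isAFS : ∀ x, IsAFS (Ψ x).target (fun k => Ψ x '' (M k ∩ (Ψ x).source))

/-- The strata seen in the chart around `x`, i.e. `Ψ x (M k ∩ B(x, r))`. -/
def RegularStratification.flatM {N : ℕ} (S : RegularStratification N) (x : E N)
    (k : Fin (N + 1)) : Set (E N) :=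
  S.Ψ x '' (S.M k ∩ (S.Ψ x).source)

/-- The set-valued map `BL` seen in the chart around `x`: a trajectory `X` becomes
`Y = Ψ x ∘ X`, so that velocities `b` at `χ y`, `χ = (Ψ x)⁻¹`, become `DΨ (χ y) b` at `y`. -/
def RegularStratification.flatBL {N : ℕ} (S : RegularStratification N) (x : E N)
    (BL : E N × ℝ → Set (E N × ℝ)) (z : E N × ℝ) : Set (E N × ℝ) :=
  (fun bl : E N × ℝ => (fderiv ℝ (S.Ψ x) ((S.Ψ x).symm z.1) bl.1, bl.2)) ''
    BL ((S.Ψ x).symm z.1, z.2)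

/-- Tangential continuity: around each point `x` of each stratum `M k`, in the flat coordinates. The
constant and the modulus depend on `x`. -/
def TangentialContinuity {N : ℕ} (T : ℝ) (BL : E N × ℝ → Set (E N × ℝ))
    (S : RegularStratification N) : Prop :=
  ∀ k, ∀ x ∈ S.M k, ∃ r V, IsFlatAt (S.Ψ x).target (S.flatM x) k (S.Ψ x x) r V ∧
    ∃ (C : ℝ) (m : ℝ → ℝ), (∀ s ≥ 0, 0 ≤ m s) ∧ Tendsto m (𝓝[>] 0) (𝓝 0) ∧
      ∀ j ≥ k, ∀ y₁ ∈ S.flatM x j ∩ Metric.ball (S.Ψ x x) r,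
        ∀ y₂ ∈ S.flatM x j ∩ Metric.ball (S.Ψ x x) r, y₁ - y₂ ∈ V → ∀ t ∈ Icc 0 T,
          Metric.hausdorffDist (Prod.fst '' S.flatBL x BL (y₁, t))
              (Prod.fst '' S.flatBL x BL (y₂, t)) ≤ C * ‖y₁ - y₂‖ ∧
          ∀ t' ∈ Icc 0 T, Metric.hausdorffDist (S.flatBL x BL (y₁, t)) (S.flatBL x BL (y₂, t'))
            ≤ m (‖y₁ - y₂‖ + |t - t'|)

/-- Normal controllability: around each point `x` of each stratum `M k` with `k < N`, in the flat
coordinates. The constant `δ` depends on `x`. -/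
def NormalControllability {N : ℕ} (T : ℝ) (BL : E N × ℝ → Set (E N × ℝ))
    (S : RegularStratification N) : Prop :=
  ∀ k : Fin (N + 1), (k : ℕ) < N → ∀ x ∈ S.M k,
    ∃ r V, IsFlatAt (S.Ψ x).target (S.flatM x) k (S.Ψ x x) r V ∧
      ∃ δ > 0, ∀ t ∈ Icc 0 T, ∀ y ∈ Metric.ball (S.Ψ x x) r \ S.flatM x k,
        Metric.ball 0 δ ∩ (Vᗮ : Set (E N)) ⊆
          Prod.fst '' S.flatBL x BL (y, t) ∩ (Vᗮ : Set (E N))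

/-! ## Tangential Hamiltonians, envelopes, viscosity subsolutions on a stratum -/

/-- The tangent space at `x` to a submanifold `A` of `ℝ^N`: the velocities at `x` of curves lying
in `A`. -/
def tangentSpaceAt {N : ℕ} (A : Set (E N)) (x : E N) : Set (E N) :=
  {b | ∃ γ : ℝ → E N, (∀ᶠ s in 𝓝 0, γ s ∈ A) ∧ γ 0 = x ∧ HasDerivAt γ b 0}

/-- The tangential Hamiltonian on the stratum `A`,
`sup {- b · p - l : (b, l) ∈ BL (x, t), b ∈ T_x A}`. -/
def tangentialHamiltonian {N : ℕ} (BL : E N × ℝ → Set (E N × ℝ)) (A : Set (E N))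
    (x : E N) (t : ℝ) (p : E N) : ℝ :=
  sSup ((fun bl : E N × ℝ => -inner ℝ bl.1 p - bl.2) ''
    {bl | bl ∈ BL (x, t) ∧ bl.1 ∈ tangentSpaceAt A x})

/-- The upper semicontinuous envelope of the restriction of `u` to `D`: the limsup of `u z'` as
`z' → z` in `D`. It is used for `u` locally bounded and `z ∈ D`. -/
def uscEnvelope {N : ℕ} (D : Set (E N × ℝ)) (u : E N × ℝ → ℝ) (z : E N × ℝ) : ℝ :=
  limsup u (𝓝[D] z)

/-- The locally bounded function `u` on `ℝ^N × [0, T]` is a viscosity subsolution of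
`u_t + H^A (x, t, Du) = 0` on `A × (0, T)`, an equation restricted to the stratum `A`: its
usc envelope is tested at local maximum points relative to `A × (0, T)`. The test functions are
`C¹` near the point; every `C¹` function on `A × (0, T)` has such a local extension. -/
structure IsSubsolutionOnStratum {N : ℕ} (T : ℝ) (BL : E N × ℝ → Set (E N × ℝ)) (A : Set (E N))
    (u : E N × ℝ → ℝ) : Prop where
  locallyBounded : ∀ z ∈ (univ : Set (E N)) ×ˢ Icc (0 : ℝ) T,
    ∃ C, ∀ᶠ z' in 𝓝[univ ×ˢ Icc 0 T] z, |u z'| ≤ C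
  subsolution : ∀ (φ : E N × ℝ → ℝ) (x : E N) (t : ℝ), x ∈ A → t ∈ Ioo 0 T →
    ContDiffAt ℝ 1 φ (x, t) →
    IsLocalMaxOn (fun z => uscEnvelope (univ ×ˢ Icc 0 T) u z - φ z) (A ×ˢ Ioo 0 T) (x, t) →
    deriv (fun s => φ (x, s)) t +
      tangentialHamiltonian BL A x t (gradient (fun y => φ (y, t)) x) ≤ 0

end StratifiedControl

end

/-!
The proof rests on one existence theorem, `exists_solution`, for differential inclusions whose
right-hand side has a closed graph and convex values. It provides all trajectories: arbitrary ones
(`exists_trajectory`), which make the infimum in the value function one over a nonempty set, and the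
two special families below, for which the right-hand side is cut down to prescribed velocities.
Concatenating arcs with trajectories gives one half of the dynamic programming principle,
`IsArc.value_le`.

*The envelope on a stratum* (`uscEnvelope_value_eq`). In flat coordinates, normal controllability
allows one to run at speed `δ / 2` along the straight segment from a point `y` to its orthogonal
projection on the stratum. The duration and the cost are proportional to the distance to the
stratum, so that the values near `(x, t)` are controlled by values on the stratum
(`value_le_value_normal_proj`). At the initial time this leaves no room, but there the envelope is
`g x` anyway.

*The subsolution inequality* (`neg_fderiv_sub_le_zero`). Let `(b, l)` be an admissible element with
`b` tangent to the stratum. Tangential continuity yields admissible elements near `(b, l)` at all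
neighbouring points of the stratum; their small normal components are removed by a convex
combination with normal velocities, which normal controllability provides also on the stratum
(`exists_tangential_near`). Hence the dynamics restricted to tangential elements near `(b, l)` has
nonempty values, and its solutions stay on the stratum (`exists_tangential_value_le`,
`eventually_tangential_value_le`). Comparing the
value at both ends of such an arc, started from points of the stratum where the value is almost
equal to its envelope, with the test function gives `φ_t - b · Dφ - l ≤ 0`. The null velocity is
always such an element, so that the supremum in the tangential Hamiltonian runs over a nonempty set.
-/

namespace StratifiedControl

/-! ### Existence for differential inclusions with closed graph and convex values -/

section Existence

variable {W : Type*} [NormedAddCommGroup W] [NormedSpace ℝ W]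

/-- The points of the explicit Euler scheme with step `h` for the selection `f`. -/
noncomputable def eulerPoint (f : W → ℝ → W) (w₀ : W) (h : ℝ) : ℕ → W
  | 0 => w₀
  | i + 1 => eulerPoint f w₀ h i + h • f (eulerPoint f w₀ h i) (i * h)

lemma eulerPoint_sub_mem {f : W → ℝ → W} {w₀ : W} {h : ℝ} {C : Set W} (hC : Convex ℝ C)
    {p q : ℕ} (hpq : p < q)
    (hf : ∀ i, p ≤ i → i < q → f (eulerPoint f w₀ h i) (i * h) ∈ C) :
    ∃ c ∈ C, eulerPoint f w₀ h q - eulerPoint f w₀ h p = (((q : ℝ) - p) * h) • c := by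
  induction q, hpq using Nat.le_induction with
  | base =>
    refine ⟨_, hf p le_rfl (Nat.lt_succ_self p), ?_⟩
    simp [eulerPoint]
  | succ q hpq ih =>
    obtain ⟨c, hc, hcq⟩ := ih fun i hi hi' => hf i hi (hi'.trans (Nat.lt_succ_self q))
    have hpq' : (p : ℝ) < q := by exact_mod_cast hpq
    have h0 : (0 : ℝ) < q - p := by linarith
    have h1 : (0 : ℝ) < q - p + 1 := by linarith
    have hd := hf q (Nat.le_of_lt hpq) (Nat.lt_succ_self q)
    refine ⟨(((q : ℝ) - p) / (q - p + 1)) • c + (1 / ((q : ℝ) - p + 1)) • _,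
      hC hc hd (by positivity) (by positivity) (by field_simp), ?_⟩
    have : eulerPoint f w₀ h (q + 1) - eulerPoint f w₀ h p =
        (eulerPoint f w₀ h q - eulerPoint f w₀ h p) +
          h • f (eulerPoint f w₀ h q) (q * h) := by
      simp only [eulerPoint]; abel
    rw [this, hcq, smul_add, smul_smul, smul_smul]
    congr 2
    · push_cast; field_simp; ring
    · push_cast; field_simp; ring

lemma tendsto_floor_mul_step {t s : ℝ} (ht : 0 < t) (hs : 0 ≤ s) :
    Tendsto (fun n : ℕ => (⌊s / (t / ((n : ℝ) + 1))⌋₊ : ℝ) * (t / ((n : ℝ) + 1)))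
      atTop (𝓝 s) := by
  have hh : Tendsto (fun n : ℕ => t / ((n : ℝ) + 1)) atTop (𝓝 0) := by
    simpa [div_eq_mul_inv] using (tendsto_one_div_add_atTop_nhds_zero_nat (𝕜 := ℝ)).const_mul t
  refine tendsto_of_tendsto_of_tendsto_of_le_of_le (g := fun n : ℕ => s - t / ((n : ℝ) + 1))
    (h := fun _ => s) (by simpa using hh.const_sub s) tendsto_const_nhds (fun n => ?_) fun n => ?_
  · have hpos : 0 < t / ((n : ℝ) + 1) := by positivity
    have := Nat.lt_floor_add_one (s / (t / ((n : ℝ) + 1)))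
    rw [div_lt_iff₀ hpos] at this
    simp only
    nlinarith
  · have hpos : 0 < t / ((n : ℝ) + 1) := by positivity
    have := Nat.floor_le (a := s / (t / ((n : ℝ) + 1))) (by positivity)
    rwa [le_div_iff₀ hpos] at this

lemma lipschitzOnWith_Icc_of_increment {X : ℝ → W} {t M : ℝ} {C : Set W} (hM : ∀ c ∈ C, ‖c‖ ≤ M)
    (hX : ∀ s ∈ Icc 0 t, ∀ s' ∈ Icc 0 t, s ≤ s' → ∃ c ∈ C, X s' - X s = (s' - s) • c) :
    LipschitzOnWith (Real.toNNReal M) X (Icc 0 t) := by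
  refine LipschitzOnWith.of_dist_le_mul fun s hs s' hs' => ?_
  wlog hss' : s ≤ s' generalizing s s'
  · rw [dist_comm, dist_comm s]
    exact this s' hs' s hs (le_of_not_ge hss')
  obtain ⟨c, hc, hce⟩ := hX s hs s' hs' hss'
  rw [dist_comm, dist_comm s, dist_eq_norm, hce, norm_smul, Real.dist_eq, Real.norm_eq_abs,
    mul_comm]
  exact mul_le_mul_of_nonneg_right ((hM c hc).trans (Real.le_coe_toNNReal M)) (abs_nonneg _)

/-- **Existence for differential inclusions.** The values of `F` need only meet the compact convex
set `C` of admissible velocities at the points `K` that such velocities can reach. The solution is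
an ultrafilter limit of Euler schemes; its difference quotients are then limits of convex
combinations of nearby values of `F`, which the closed graph and the convexity of the values force
into `F` at every point of differentiability. -/
theorem exists_solution [FiniteDimensional ℝ W] {F : W → ℝ → Set W} {C K : Set W} {w₀ : W} {t : ℝ}
    (ht : 0 < t) (hC : IsCompact C) (hCc : Convex ℝ C) (hCne : C.Nonempty)
    (hK : ∀ s ∈ Icc 0 t, ∀ c ∈ C, w₀ + s • c ∈ K)
    (hne : ∀ w ∈ K, ∀ s ∈ Ico 0 t, (F w s ∩ C).Nonempty)
    (hconv : ∀ w ∈ K, ∀ s ∈ Ioo 0 t, Convex ℝ (F w s))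
    (hclosed : IsClosed {p : W × ℝ × W | p.1 ∈ K ∧ p.2.1 ∈ Icc 0 t ∧ p.2.2 ∈ F p.1 p.2.1}) :
    ∃ X : ℝ → W, X 0 = w₀ ∧
      (∀ s ∈ Icc 0 t, ∀ s' ∈ Icc 0 t, s ≤ s' → ∃ c ∈ C, X s' - X s = (s' - s) • c) ∧
      ∀ᵐ s ∂(volume.restrict (Ioo 0 t)), ∃ b ∈ F (X s) s, HasDerivAt X b s := by
  classical
  obtain ⟨c₀, hc₀⟩ := hCne
  obtain ⟨M, hM0, hM⟩ := hC.isBounded.exists_pos_norm_le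
  -- the selection driving the scheme always lies in `C`, so the scheme never leaves `K`
  let f : W → ℝ → W := fun w s => if h : (F w s ∩ C).Nonempty then h.some else c₀
  have hfC : ∀ w s, f w s ∈ C := fun w s => by
    by_cases h : (F w s ∩ C).Nonempty
    · simpa [f, h] using h.some_mem.2
    · simpa [f, h] using hc₀
  have hfF : ∀ w ∈ K, ∀ s ∈ Ico 0 t, f w s ∈ F w s := fun w hw s hs => by
    simpa [f, hne w hw s hs] using (hne w hw s hs).some_mem.1
  let h : ℕ → ℝ := fun n => t / ((n : ℝ) + 1)
  have hpos : ∀ n, 0 < h n := fun n => by positivity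
  have hlim : Tendsto h atTop (𝓝 0) := by
    simpa [h, div_eq_mul_inv] using
      (tendsto_one_div_add_atTop_nhds_zero_nat (𝕜 := ℝ)).const_mul t
  let x : ℕ → ℕ → W := fun n => eulerPoint f w₀ (h n)
  let ι : ℕ → ℝ → ℕ := fun n s => ⌊s / h n⌋₊
  have hι : ∀ n s, 0 ≤ s → (ι n s : ℝ) * h n ≤ s := fun n s hs => by
    have := Nat.floor_le (a := s / h n) (by have := hpos n; positivity)
    rwa [le_div_iff₀ (hpos n)] at this
  have hι' : ∀ n s, s < (ι n s : ℝ) * h n + h n := fun n s => by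
    have := Nat.lt_floor_add_one (s / h n)
    rw [div_lt_iff₀ (hpos n)] at this
    simp only [ι]
    linarith
  have hlt : ∀ n s i, 0 ≤ s → i < ι n s → (i : ℝ) * h n < s := fun n s i hs hi => by
    have h1 : (i : ℝ) < ι n s := by exact_mod_cast hi
    nlinarith [hι n s hs, hpos n]
  have hsub : ∀ n p q, p ≤ q → ∃ c ∈ C, x n q - x n p = (((q : ℝ) - p) * h n) • c := by
    intro n p q hpq
    rcases hpq.eq_or_lt with rfl | hpq
    · exact ⟨c₀, hc₀, by simp⟩
    · exact eulerPoint_sub_mem hCc hpq fun i _ _ => hfC _ _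
  have hsub0 : ∀ n i, ∃ c ∈ C, x n i = w₀ + ((i : ℝ) * h n) • c := by
    intro n i
    obtain ⟨c, hc, hci⟩ := hsub n 0 i (Nat.zero_le i)
    refine ⟨c, hc, ?_⟩
    rw [sub_eq_iff_eq_add'] at hci
    simpa [x, eulerPoint] using hci
  have hxK : ∀ n (i : ℕ), (i : ℝ) * h n ≤ t → x n i ∈ K := by
    intro n i hi
    obtain ⟨c, hc, hci⟩ := hsub0 n i
    rw [hci]
    exact hK _ ⟨by have := hpos n; positivity, hi⟩ c hc
  let U : Ultrafilter ℕ := hyperfilter ℕ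
  have hU : (U : Filter ℕ) ≤ atTop := Nat.hyperfilter_le_atTop
  have hcpt : IsCompact ((fun p : ℝ × W => w₀ + p.1 • p.2) '' (Icc 0 t ×ˢ C)) :=
    (isCompact_Icc.prod hC).image (by fun_prop)
  have hXex : ∀ s, ∃ y : W, s ∈ Icc 0 t → Tendsto (fun n => x n (ι n s)) U (𝓝 y) := by
    intro s
    by_cases hs : s ∈ Icc 0 t
    · obtain ⟨y, -, hy⟩ := hcpt.ultrafilter_le_nhds' (U.map fun n => x n (ι n s))
        (Filter.Eventually.of_forall (f := (U : Filter ℕ)) fun n => by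
          obtain ⟨c, hc, hci⟩ := hsub0 n (ι n s)
          refine ⟨((ι n s : ℝ) * h n, c), ⟨⟨?_, (hι n s hs.1).trans hs.2⟩, hc⟩, hci.symm⟩
          have := hpos n; positivity)
      exact ⟨y, fun _ => hy⟩
    · exact ⟨w₀, fun h => absurd h hs⟩
  choose X hX using hXex
  have hιlim : ∀ s, 0 ≤ s → Tendsto (fun n => (ι n s : ℝ) * h n) U (𝓝 s) := fun s hs =>
    (tendsto_floor_mul_step ht hs).mono_left hU
  have hgap : ∀ s ∈ Icc 0 t, ∀ s' ∈ Icc 0 t,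
      Tendsto (fun n => ((ι n s' : ℝ) - ι n s) * h n) U (𝓝 (s' - s)) := by
    intro s hs s' hs'
    simpa only [sub_mul] using (hιlim s' hs'.1).sub (hιlim s hs.1)
  have hincr : ∀ s ∈ Icc 0 t, ∀ s' ∈ Icc 0 t, s < s' → ∀ C' : Set W, Convex ℝ C' → IsClosed C' →
      (∀ᶠ n in (U : Filter ℕ), ∀ i, ι n s ≤ i → i < ι n s' → f (x n i) (i * h n) ∈ C') →
      (s' - s)⁻¹ • (X s' - X s) ∈ C' := by
    intro s hs s' hs' hss' C' hC'c hC' hev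
    have h1 : Tendsto (fun n => (((ι n s' : ℝ) - ι n s) * h n)⁻¹ •
        (x n (ι n s') - x n (ι n s))) U (𝓝 ((s' - s)⁻¹ • (X s' - X s))) :=
      ((hgap s hs s' hs').inv₀ (sub_pos.2 hss').ne').smul ((hX s' hs').sub (hX s hs))
    refine hC'.mem_of_tendsto h1 ?_
    filter_upwards [hev, (hgap s hs s' hs').eventually_const_lt (sub_pos.2 hss')] with n hn hgn
    have hpq : ι n s < ι n s' := by
      have : (0 : ℝ) < (ι n s' : ℝ) - ι n s := (pos_iff_pos_of_mul_pos hgn).2 (hpos n)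
      exact_mod_cast sub_pos.1 this
    obtain ⟨c, hc, hce⟩ := eulerPoint_sub_mem (f := f) (w₀ := w₀) hC'c hpq hn
    simp only [x]
    rw [hce, smul_smul, inv_mul_cancel₀ hgn.ne', one_smul]
    exact hc
  have hincrC : ∀ s ∈ Icc 0 t, ∀ s' ∈ Icc 0 t, s ≤ s' →
      ∃ c ∈ C, X s' - X s = (s' - s) • c := by
    intro s hs s' hs' hss'
    rcases hss'.eq_or_lt with rfl | hss'
    · exact ⟨c₀, hc₀, by simp⟩
    · refine ⟨_, hincr s hs s' hs' hss' C hCc hC.isClosed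
        (Filter.Eventually.of_forall fun n i _ _ => hfC _ _), ?_⟩
      rw [smul_smul, mul_inv_cancel₀ (sub_pos.2 hss').ne', one_smul]
  have hX0 : X 0 = w₀ := by
    refine tendsto_nhds_unique (hX 0 ⟨le_rfl, ht.le⟩) ?_
    have : (fun n => x n (ι n 0)) = fun _ => w₀ := by
      funext n; simp [ι, x, eulerPoint]
    rw [this]
    exact tendsto_const_nhds
  have hXK : ∀ s ∈ Icc 0 t, X s ∈ K := by
    intro s hs
    obtain ⟨c, hc, hce⟩ := hincrC 0 ⟨le_rfl, ht.le⟩ s hs hs.1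
    rw [hX0, sub_zero, sub_eq_iff_eq_add'] at hce
    rw [hce]
    exact hK s hs c hc
  have hLip := lipschitzOnWith_Icc_of_increment hM hincrC
  refine ⟨X, hX0, hincrC, ?_⟩
  have hdiff := hLip.ae_differentiableWithinAt_of_mem (μ := volume)
  rw [ae_restrict_iff' measurableSet_Ioo]
  filter_upwards [hdiff] with s hsd hs
  have hs' : s ∈ Icc 0 t := Ioo_subset_Icc_self hs
  have hd : HasDerivAt X (deriv X s) s :=
    ((hsd hs').differentiableAt (Icc_mem_nhds hs.1 hs.2)).hasDerivAt
  refine ⟨deriv X s, ?_, hd⟩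
  set b := deriv X s
  -- it suffices that `b` is in every closed neighbourhood of the compact convex set `F (X s) s ∩ C`
  have hF₀ : IsClosed (F (X s) s ∩ C) := by
    have : F (X s) s ∩ C = (fun v => ((X s, s, v) : W × ℝ × W)) ⁻¹'
        {p : W × ℝ × W | p.1 ∈ K ∧ p.2.1 ∈ Icc 0 t ∧ p.2.2 ∈ F p.1 p.2.1} ∩ C := by
      ext v
      simp only [mem_inter_iff, mem_preimage, mem_ofPred_eq]
      simp [hXK s hs', hs'.1, hs'.2]
    rw [this]
    exact (hclosed.preimage (by fun_prop)).inter hC.isClosed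
  suffices hb : b ∈ F (X s) s ∩ C from hb.1
  rw [← hF₀.closure_eq, Metric.closure_eq_iInter_cthickening]
  simp only [mem_iInter]
  intro ε hε
  set O := Metric.thickening ε (F (X s) s ∩ C)
  have hnear : ∀ᶠ p : W × ℝ in 𝓝 (X s, s), ∀ v ∈ C \ O, ¬ (p.1 ∈ K ∧ p.2 ∈ Icc 0 t ∧
      v ∈ F p.1 p.2) := by
    refine (hC.diff Metric.isOpen_thickening).eventually_forall_of_forall_eventually fun v hv => ?_
    have hvn : (X s, s, v) ∉ {p : W × ℝ × W | p.1 ∈ K ∧ p.2.1 ∈ Icc 0 t ∧ p.2.2 ∈ F p.1 p.2.1} :=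
      fun hcon => hv.2 (Metric.self_subset_thickening hε _ ⟨hcon.2.2, hv.1⟩)
    have hcont : Continuous fun z : (W × ℝ) × W => (z.1.1, z.1.2, z.2) := by fun_prop
    exact (hcont.continuousAt (x := ((X s, s), v))).eventually
      (hclosed.isOpen_compl.mem_nhds hvn)
  obtain ⟨η, hη, hball⟩ := Metric.eventually_nhds_iff.1 hnear
  have hslope : Tendsto (fun r : ℝ => r⁻¹ • (X (s + r) - X s)) (𝓝[>] 0) (𝓝 b) :=
    hd.tendsto_slope_zero_right
  refine Metric.isClosed_cthickening.mem_of_tendsto hslope ?_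
  have hr0 : 0 < min (min (η / 4) (η / (4 * M))) (t - s) := by
    have := sub_pos.2 hs.2
    positivity
  filter_upwards [Ioo_mem_nhdsGT hr0] with r hr
  have hrη : r < η / 4 := hr.2.trans_le ((min_le_left _ _).trans (min_le_left _ _))
  have hrM : r * M < η / 4 := by
    have : r < η / (4 * M) := hr.2.trans_le ((min_le_left _ _).trans (min_le_right _ _))
    rw [lt_div_iff₀ (by positivity)] at this
    linarith
  have hrt : r < t - s := hr.2.trans_le (min_le_right _ _)
  have hsr : s + r ∈ Icc 0 t := ⟨by linarith [hs.1, hr.1], by linarith⟩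
  have := hincr s hs' (s + r) hsr (by linarith [hr.1]) (Metric.cthickening ε (F (X s) s ∩ C))
    (((hconv _ (hXK s hs') s hs).inter hCc).cthickening ε) Metric.isClosed_cthickening ?_
  · simpa using this
  have hh1 : ∀ᶠ n in (U : Filter ℕ), h n < η / 4 :=
    (hlim.mono_left hU).eventually_lt_const (by positivity)
  have hh2 : ∀ᶠ n in (U : Filter ℕ), h n < η / (4 * M) :=
    (hlim.mono_left hU).eventually_lt_const (by positivity)
  have hh3 : ∀ᶠ n in (U : Filter ℕ), dist (x n (ι n s)) (X s) < η / 4 :=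
    (hX s hs').eventually (Metric.ball_mem_nhds _ (by positivity))
  filter_upwards [hh1, hh2, hh3] with n h1 h2 h3 i hi1 hi2
  have hhM : h n * M < η / 4 := by
    rw [lt_div_iff₀ (by positivity)] at h2
    linarith
  have hti : (i : ℝ) * h n < s + r := hlt n _ i hsr.1 hi2
  have hi1' : (ι n s : ℝ) ≤ i := by exact_mod_cast hi1
  have hti' : s - h n < i * h n := by
    nlinarith [hι' n s, hpos n]
  have htIcc : (i : ℝ) * h n ∈ Ico 0 t := ⟨by have := hpos n; positivity, by linarith⟩
  have hdist : dist (x n i) (x n (ι n s)) < η / 2 := by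
    obtain ⟨c, hc, hce⟩ := hsub n _ i hi1
    have hnn : 0 ≤ ((i : ℝ) - ι n s) * h n := mul_nonneg (sub_nonneg.2 hi1') (hpos n).le
    rw [dist_eq_norm, hce, norm_smul, Real.norm_eq_abs, abs_of_nonneg hnn]
    calc ((i : ℝ) - ι n s) * h n * ‖c‖ ≤ (r + h n) * M := by
          refine mul_le_mul ?_ (hM c hc) (norm_nonneg _) ?_
          · linarith [hι' n s]
          · linarith [hr.1, hpos n]
      _ < η / 2 := by linarith
  have hmem := hball (y := (x n i, i * h n)) (by
    rw [Prod.dist_eq]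
    refine max_lt ?_ ?_
    · linarith [dist_triangle (x n i) (x n (ι n s)) (X s)]
    · rw [Real.dist_eq, abs_lt]
      constructor <;> simp only <;> linarith)
  refine Metric.thickening_subset_cthickening _ _ ?_
  by_contra hcon
  exact hmem _ ⟨hfC _ _, hcon⟩ ⟨hxK n i htIcc.2.le, Ico_subset_Icc_self htIcc,
    hfF _ (hxK n i htIcc.2.le) _ htIcc⟩

end Existence

/-! ### Trajectories and the dynamic programming inequality -/

section Dynamics

variable {N : ℕ} {T : ℝ} {BL : E N × ℝ → Set (E N × ℝ)}

lemma IsBL.isClosed_graph (hBL : IsBL T BL) :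
    IsClosed {p : (E N × ℝ) × (E N × ℝ) | p.1.2 ∈ Icc 0 T ∧ p.2 ∈ BL p.1} := by
  refine isClosed_of_closure_subset fun p hp => ?_
  rw [mem_closure_iff_frequently] at hp
  have hpT : p.1.2 ∈ Icc 0 T := by
    have hcl : IsClosed {q : (E N × ℝ) × (E N × ℝ) | q.1.2 ∈ Icc 0 T} :=
      isClosed_Icc.preimage (by fun_prop : Continuous fun q : (E N × ℝ) × (E N × ℝ) => q.1.2)
    exact hcl.closure_subset (mem_closure_iff_frequently.2 (hp.mono fun q hq => hq.1))
  refine ⟨hpT, ?_⟩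
  have hcl : IsClosed (BL p.1) := (hBL.isCompact p.1.1 p.1.2 hpT).isClosed
  by_contra hcon
  obtain ⟨s, hs, u, hu, hsu⟩ := Filter.disjoint_iff.1 (RegularSpace.regular hcl hcon)
  have husc := upperHemicontinuousOn_iff.1 hBL.usc p.1 ⟨mem_univ _, hpT⟩
  rw [upperHemicontinuousWithinAt_iff] at husc
  have h1 := eventually_nhdsWithin_iff.1 (husc s hs)
  have h2 := (continuous_fst.tendsto p).eventually h1
  have h3 := (continuous_snd.tendsto p).eventually hu
  obtain ⟨q, hq, hq1, hq2⟩ := (hp.and_eventually (h2.and h3)).exists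
  exact hsu.notMem_of_mem_left (subset_of_mem_nhdsSet (hq1 ⟨mem_univ _, hq.1⟩) hq.2) hq2

/-- A trajectory of `(X, L)' (s) ∈ BL (X s, t - s)` starting from `(x, t)` and followed only up to
the time `τ`. -/
structure IsArc (BL : E N × ℝ → Set (E N × ℝ)) (x : E N) (t τ : ℝ)
    (X : ℝ → E N) (L : ℝ → ℝ) : Prop where
  lipschitz_X : ∃ K, LipschitzOnWith K X (Icc 0 τ)
  lipschitz_L : ∃ K, LipschitzOnWith K L (Icc 0 τ)
  start_X : X 0 = x
  start_L : L 0 = 0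
  inclusion : ∀ᵐ s ∂(volume.restrict (Ioo 0 τ)),
    ∃ b l, (b, l) ∈ BL (X s, t - s) ∧ HasDerivAt X b s ∧ HasDerivAt L l s

lemma IsTrajectory.isArc {x : E N} {t : ℝ} {X : ℝ → E N} {L : ℝ → ℝ}
    (h : IsTrajectory BL x t X L) : IsArc BL x t t X L :=
  ⟨h.lipschitz_X, h.lipschitz_L, h.start_X, h.start_L, h.inclusion⟩

lemma exists_trajectory (hBL : IsBL T BL) {M : ℝ} (hM0 : 0 < M)
    (hM : ∀ x, ∀ t ∈ Ioc 0 T, ∀ b l, (b, l) ∈ BL (x, t) → ‖b‖ ≤ M ∧ |l| ≤ M)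
    (x : E N) {t : ℝ} (ht : t ∈ Icc 0 T) :
    ∃ X L, IsTrajectory BL x t X L ∧ dist (X t) x ≤ M * t := by
  rcases ht.1.eq_or_lt with rfl | ht0
  · refine ⟨fun _ => x, fun _ => 0, ⟨⟨0, ?_⟩, ⟨0, ?_⟩, rfl, rfl, by simp⟩, by simp⟩
    · exact (LipschitzWith.const x).lipschitzOnWith
    · exact (LipschitzWith.const (0 : ℝ)).lipschitzOnWith
  obtain ⟨Z, hZ0, hZ, hZd⟩ := exists_solution (W := E N × ℝ) (w₀ := (x, 0)) (K := univ)
    (C := Metric.closedBall 0 M) (F := fun w s => BL (w.1, t - s)) ht0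
    (isCompact_closedBall _ _) (convex_closedBall _ _) ⟨0, by simp [hM0.le]⟩
    (fun _ _ _ _ => mem_univ _)
    (fun w _ s hs => by
      have hts : t - s ∈ Ioc 0 T := ⟨by linarith [hs.2], by linarith [hs.1, ht.2]⟩
      obtain ⟨⟨b, l⟩, hbl⟩ := hBL.nonempty w.1 (t - s) (Ioc_subset_Icc_self hts)
      refine ⟨(b, l), hbl, ?_⟩
      have := hM _ _ hts b l hbl
      simp only [mem_closedBall_zero_iff, Prod.norm_def, Real.norm_eq_abs]
      exact max_le this.1 this.2)
    (fun w _ s hs => hBL.convex _ _ ⟨by linarith [hs.2], by linarith [hs.1, ht.2]⟩)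
    (by
      have : {p : (E N × ℝ) × ℝ × (E N × ℝ) |
          p.1 ∈ univ ∧ p.2.1 ∈ Icc 0 t ∧ p.2.2 ∈ BL (p.1.1, t - p.2.1)} =
          {p | p.2.1 ∈ Icc 0 t} ∩ (fun p => ((p.1.1, t - p.2.1), p.2.2)) ⁻¹'
            {p : (E N × ℝ) × (E N × ℝ) | p.1.2 ∈ Icc 0 T ∧ p.2 ∈ BL p.1} := by
        ext p
        simp only [mem_univ, true_and, mem_inter_iff, mem_ofPred_eq, mem_preimage, mem_Icc]
        constructor
        · rintro ⟨h1, h2⟩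
          exact ⟨h1, ⟨by linarith, by linarith [ht.2]⟩, h2⟩
        · rintro ⟨h1, -, h2⟩
          exact ⟨h1, h2⟩
      rw [this]
      exact (isClosed_Icc.preimage (by fun_prop)).inter
        (hBL.isClosed_graph.preimage (by fun_prop)))
  have hLip := lipschitzOnWith_Icc_of_increment (M := M) (fun c hc => by simpa using hc) hZ
  refine ⟨fun s => (Z s).1, fun s => (Z s).2, 
    ⟨⟨_, LipschitzWith.prod_fst.comp_lipschitzOnWith hLip⟩,
      ⟨_, LipschitzWith.prod_snd.comp_lipschitzOnWith hLip⟩, by simp [hZ0], by simp [hZ0], ?_⟩, ?_⟩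
  · filter_upwards [hZd] with s ⟨b, hb, hd⟩
    exact ⟨b.1, b.2, hb, hd.fst, hd.snd⟩
  · have h1 := hLip.dist_le_mul t ⟨ht0.le, le_rfl⟩ 0 ⟨le_rfl, ht0.le⟩
    rw [Real.coe_toNNReal M hM0.le, Real.dist_eq, sub_zero, abs_of_pos ht0, hZ0] at h1
    exact (le_max_left _ _).trans (Prod.dist_eq (x := Z t) (y := (x, (0 : ℝ))) ▸ h1)

lemma IsArc.norm_deriv_le {M : ℝ}
    (hM : ∀ x, ∀ t ∈ Ioc 0 T, ∀ b l, (b, l) ∈ BL (x, t) → ‖b‖ ≤ M ∧ |l| ≤ M)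
    {x : E N} {t τ : ℝ} {X : ℝ → E N} {L : ℝ → ℝ} (h : IsArc BL x t τ X L)
    (hτ : τ ≤ t) (ht : t ≤ T) :
    ∀ᵐ s ∂(volume.restrict (Ioo 0 τ)), ‖deriv L s‖ ≤ M := by
  filter_upwards [h.inclusion, ae_restrict_mem measurableSet_Ioo] with s ⟨b, l, hbl, _, hl⟩ hs
  rw [hl.deriv]
  exact (hM _ _ ⟨by linarith [hs.2], by linarith [hs.1]⟩ b l hbl).2

lemma intervalIntegrable_deriv_of_bound {L : ℝ → ℝ} {M τ : ℝ} (hτ : 0 ≤ τ)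
    (h : ∀ᵐ s ∂(volume.restrict (Ioo 0 τ)), ‖deriv L s‖ ≤ M) :
    IntervalIntegrable (deriv L) volume 0 τ := by
  rw [intervalIntegrable_iff_integrableOn_Ioo_of_le hτ]
  exact Measure.integrableOn_of_bounded (by simp) (measurable_deriv L).aestronglyMeasurable h

lemma abs_integral_deriv_le {L : ℝ → ℝ} {M τ : ℝ} (hτ : 0 ≤ τ)
    (h : ∀ᵐ s ∂(volume.restrict (Ioo 0 τ)), ‖deriv L s‖ ≤ M) :
    |∫ s in (0 : ℝ)..τ, deriv L s| ≤ M * τ := by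
  have := intervalIntegral.norm_integral_le_of_norm_le_const_ae (a := 0) (b := τ) (C := M)
    (f := deriv L) (by
      rw [uIoc_of_le hτ]
      rwa [restrict_Ioo_eq_restrict_Ioc, ae_restrict_iff' measurableSet_Ioc] at h)
  rwa [Real.norm_eq_abs, sub_zero, abs_of_nonneg hτ] at this

lemma integral_deriv_le_of_le {L : ℝ → ℝ} {M τ c : ℝ} (hτ : 0 ≤ τ)
    (h : ∀ᵐ s ∂(volume.restrict (Ioo 0 τ)), ‖deriv L s‖ ≤ M)
    (hc : ∀ᵐ s ∂(volume.restrict (Ioo 0 τ)), deriv L s ≤ c) :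
    ∫ s in (0 : ℝ)..τ, deriv L s ≤ c * τ := by
  have := intervalIntegral.integral_mono_ae_restrict hτ (intervalIntegrable_deriv_of_bound hτ h)
    (intervalIntegrable_const (c := c)) (by
      rw [restrict_Ioo_eq_restrict_Ioc, restrict_Ioc_eq_restrict_Icc] at hc
      exact hc)
  simpa [mul_comm] using this

lemma lipschitzOnWith_Icc_union {W : Type*} [PseudoMetricSpace W] {f : ℝ → W} {a τ b : ℝ}
    {K₁ K₂ : NNReal} (h₁ : LipschitzOnWith K₁ f (Icc a τ)) (h₂ : LipschitzOnWith K₂ f (Icc τ b)) :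
    LipschitzOnWith (max K₁ K₂) f (Icc a b) := by
  have h₁' := h₁.weaken (le_max_left K₁ K₂)
  have h₂' := h₂.weaken (le_max_right K₁ K₂)
  refine LipschitzOnWith.of_dist_le_mul fun s hs s' hs' => ?_
  wlog hss' : s ≤ s' generalizing s s'
  · rw [dist_comm, dist_comm s]
    exact this s' hs' s hs (le_of_not_ge hss')
  rcases le_total s' τ with h | h
  · exact h₁'.dist_le_mul s ⟨hs.1, hss'.trans h⟩ s' ⟨hs'.1, h⟩
  rcases le_total τ s with h' | h'
  · exact h₂'.dist_le_mul s ⟨h', hs.2⟩ s' ⟨h, hs'.2⟩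
  have e1 := h₁'.dist_le_mul s ⟨hs.1, h'⟩ τ ⟨hs.1.trans h', le_rfl⟩
  have e2 := h₂'.dist_le_mul τ ⟨le_rfl, h.trans hs'.2⟩ s' ⟨h, hs'.2⟩
  rw [Real.dist_eq, abs_of_nonpos (by linarith)] at e1 e2 ⊢
  nlinarith [dist_triangle (f s) (f τ) (f s')]

lemma lipschitzOnWith_comp_sub {W : Type*} [PseudoMetricSpace W] {f : ℝ → W} {τ t : ℝ}
    {K : NNReal} (h : LipschitzOnWith K f (Icc 0 (t - τ))) :
    LipschitzOnWith K (fun s => f (s - τ)) (Icc τ t) := by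
  refine LipschitzOnWith.of_dist_le_mul fun s hs s' hs' => ?_
  simpa [Real.dist_eq] using h.dist_le_mul (s - τ) ⟨by linarith [hs.1], by linarith [hs.2]⟩
    (s' - τ) ⟨by linarith [hs'.1], by linarith [hs'.2]⟩

/-- An arc followed by a trajectory from its end point is a trajectory, and costs add up. -/
lemma IsArc.concat {x : E N} {t τ : ℝ} {X X₂ : ℝ → E N} {L L₂ : ℝ → ℝ}
    (h : IsArc BL x t τ X L) (hτ0 : 0 ≤ τ) (hτt : τ ≤ t) {M : ℝ}
    (hb : ∀ᵐ s ∂(volume.restrict (Ioo 0 τ)), ‖deriv L s‖ ≤ M)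
    (h₂ : IsTrajectory BL (X τ) (t - τ) X₂ L₂)
    (hb₂ : ∀ᵐ s ∂(volume.restrict (Ioo 0 (t - τ))), ‖deriv L₂ s‖ ≤ M) :
    ∃ Y J, IsTrajectory BL x t Y J ∧ Y t = X₂ (t - τ) ∧
      ∫ s in (0 : ℝ)..t, deriv J s =
        (∫ s in (0 : ℝ)..τ, deriv L s) + ∫ s in (0 : ℝ)..(t - τ), deriv L₂ s := by
  let Y : ℝ → E N := fun s => if s ≤ τ then X s else X₂ (s - τ)
  let J : ℝ → ℝ := fun s => if s ≤ τ then L s else L τ + L₂ (s - τ)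
  have hY1 : ∀ s, s ≤ τ → Y s = X s := fun s hs => by simp [Y, hs]
  have hJ1 : ∀ s, s ≤ τ → J s = L s := fun s hs => by simp [J, hs]
  have hY2 : ∀ s, τ ≤ s → Y s = X₂ (s - τ) := fun s hs => by
    rcases hs.eq_or_lt with rfl | hs
    · simp [Y, h₂.start_X]
    · simp [Y, not_le.2 hs]
  have hJ2 : ∀ s, τ ≤ s → J s = L τ + L₂ (s - τ) := fun s hs => by
    rcases hs.eq_or_lt with rfl | hs
    · simp [J, h₂.start_L]
    · simp [J, not_le.2 hs]
  have eY1 : ∀ s, s < τ → Y =ᶠ[𝓝 s] X := fun s hs => by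
    filter_upwards [Iio_mem_nhds hs] with r hr using hY1 r (le_of_lt hr)
  have eJ1 : ∀ s, s < τ → J =ᶠ[𝓝 s] L := fun s hs => by
    filter_upwards [Iio_mem_nhds hs] with r hr using hJ1 r (le_of_lt hr)
  have eY2 : ∀ s, τ < s → Y =ᶠ[𝓝 s] fun r => X₂ (r - τ) := fun s hs => by
    filter_upwards [Ioi_mem_nhds hs] with r hr using hY2 r (le_of_lt hr)
  have eJ2 : ∀ s, τ < s → J =ᶠ[𝓝 s] fun r => L τ + L₂ (r - τ) := fun s hs => by
    filter_upwards [Ioi_mem_nhds hs] with r hr using hJ2 r (le_of_lt hr)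
  have hshift : ∀ {p : ℝ → Prop}, (∀ᵐ s ∂(volume.restrict (Ioo 0 (t - τ))), p s) →
      ∀ᵐ s, s ∈ Ioo τ t → p (s - τ) := by
    intro p hp
    rw [ae_restrict_iff' measurableSet_Ioo] at hp
    have := (measurePreserving_sub_right volume τ).quasiMeasurePreserving.ae hp
    filter_upwards [this] with s hs hst
    exact hs ⟨by linarith [hst.1], by linarith [hst.2]⟩
  obtain ⟨K₁, hK₁⟩ := h.lipschitz_X
  obtain ⟨K₂, hK₂⟩ := h₂.lipschitz_X
  obtain ⟨K₃, hK₃⟩ := h.lipschitz_L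
  obtain ⟨K₄, hK₄⟩ := h₂.lipschitz_L
  refine ⟨Y, J, ⟨⟨max K₁ K₂, ?_⟩, ⟨max K₃ K₄, ?_⟩, ?_, ?_, ?_⟩, hY2 t hτt, ?_⟩
  · refine lipschitzOnWith_Icc_union (τ := τ) (fun s hs s' hs' => ?_) fun s hs s' hs' => ?_
    · rw [hY1 s hs.2, hY1 s' hs'.2]
      exact hK₁ hs hs'
    · rw [hY2 s hs.1, hY2 s' hs'.1]
      exact lipschitzOnWith_comp_sub hK₂ hs hs'
  · refine lipschitzOnWith_Icc_union (τ := τ) (fun s hs s' hs' => ?_) fun s hs s' hs' => ?_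
    · rw [hJ1 s hs.2, hJ1 s' hs'.2]
      exact hK₃ hs hs'
    · rw [hJ2 s hs.1, hJ2 s' hs'.1, edist_add_left]
      exact lipschitzOnWith_comp_sub hK₄ hs hs'
  · rw [hY1 0 hτ0, h.start_X]
  · rw [hJ1 0 hτ0, h.start_L]
  · rw [ae_restrict_iff' measurableSet_Ioo]
    have hne : ∀ᵐ s : ℝ, s ≠ τ := by simp [ae_iff]
    have hi := h.inclusion
    rw [ae_restrict_iff' measurableSet_Ioo] at hi
    filter_upwards [hi, hshift h₂.inclusion, hne] with s h1 h2 hsτ hs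
    rcases hsτ.lt_or_gt with hlt | hgt
    · obtain ⟨b, l, hbl, hXd, hLd⟩ := h1 ⟨hs.1, hlt⟩
      refine ⟨b, l, ?_, hXd.congr_of_eventuallyEq (eY1 s hlt), hLd.congr_of_eventuallyEq (eJ1 s hlt)⟩
      rwa [hY1 s hlt.le]
    · obtain ⟨b, l, hbl, hXd, hLd⟩ := h2 ⟨hgt, hs.2⟩
      refine ⟨b, l, ?_, (hXd.comp_sub_const s τ).congr_of_eventuallyEq (eY2 s hgt),
        ((hLd.comp_sub_const s τ).const_add (L τ)).congr_of_eventuallyEq (eJ2 s hgt)⟩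
      rw [hY2 s hgt.le]
      convert hbl using 3
      ring
  · have e1 : ∫ s in (0 : ℝ)..τ, deriv J s = ∫ s in (0 : ℝ)..τ, deriv L s :=
      intervalIntegral.integral_congr_Ioo_of_le hτ0 fun s hs => (eJ1 s hs.2).deriv_eq
    have d2 : EqOn (deriv J) (fun s => deriv L₂ (s - τ)) (Ioo τ t) := fun s hs => by
      rw [(eJ2 s hs.1).deriv_eq, deriv_const_add, deriv_comp_sub_const]
    have e2 : ∫ s in τ..t, deriv J s = ∫ s in (0 : ℝ)..(t - τ), deriv L₂ s := by
      rw [intervalIntegral.integral_congr_Ioo_of_le hτt d2,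
        intervalIntegral.integral_comp_sub_right (fun s => deriv L₂ s), sub_self]
    have i1 : IntervalIntegrable (deriv J) volume 0 τ := by
      refine intervalIntegrable_deriv_of_bound (M := M) hτ0 ?_
      filter_upwards [hb, ae_restrict_mem measurableSet_Ioo] with s hs hs'
      rwa [(eJ1 s hs'.2).deriv_eq]
    have i2 : IntervalIntegrable (deriv J) volume τ t := by
      rw [intervalIntegrable_iff_integrableOn_Ioo_of_le hτt]
      refine Measure.integrableOn_of_bounded (M := M) (by simp)
        (measurable_deriv J).aestronglyMeasurable ?_
      rw [ae_restrict_iff' measurableSet_Ioo]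
      filter_upwards [hshift hb₂] with s hs hs'
      rw [d2 hs']
      exact hs hs'
    rw [← intervalIntegral.integral_add_adjacent_intervals i1 i2, e1, e2]

/-- The costs of the trajectories from `z`, whose infimum is the value function. -/
def costs (BL : E N × ℝ → Set (E N × ℝ)) (g : E N → ℝ) (z : E N × ℝ) : Set ℝ :=
  {c | ∃ X L, IsTrajectory BL z.1 z.2 X L ∧
    c = (∫ s in (0 : ℝ)..z.2, deriv L s) + g (X z.2)}

variable {g : E N → ℝ}

lemma abs_le_of_mem_costs {M C : ℝ} (hM0 : 0 < M)
    (hM : ∀ x, ∀ t ∈ Ioc 0 T, ∀ b l, (b, l) ∈ BL (x, t) → ‖b‖ ≤ M ∧ |l| ≤ M)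
    (hg : ∀ x, |g x| ≤ C) {z : E N × ℝ} (hz : z.2 ∈ Icc 0 T) {c : ℝ} (hc : c ∈ costs BL g z) :
    |c| ≤ M * T + C := by
  obtain ⟨X, L, h, rfl⟩ := hc
  have h1 := abs_integral_deriv_le hz.1 (h.isArc.norm_deriv_le hM le_rfl hz.2)
  have h2 := hg (X z.2)
  have h3 : M * z.2 ≤ M * T := mul_le_mul_of_nonneg_left hz.2 hM0.le
  exact (abs_add_le _ _).trans (by linarith)

lemma costs_nonempty (hBL : IsBL T BL) {z : E N × ℝ} (hz : z.2 ∈ Icc 0 T) :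
    (costs BL g z).Nonempty := by
  obtain ⟨M, hM0, hM⟩ := hBL.bounded
  obtain ⟨X, L, h, -⟩ := exists_trajectory hBL hM0 hM z.1 hz
  exact ⟨_, X, L, h, rfl⟩

lemma bddBelow_costs (hBL : IsBL T BL) (hg : ∃ C, ∀ x, |g x| ≤ C) {z : E N × ℝ}
    (hz : z.2 ∈ Icc 0 T) : BddBelow (costs BL g z) := by
  obtain ⟨M, hM0, hM⟩ := hBL.bounded
  obtain ⟨C, hC⟩ := hg
  exact ⟨-(M * T + C), fun c hc => (abs_le.1 (abs_le_of_mem_costs hM0 hM hC hz hc)).1⟩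

lemma exists_abs_value_le (hBL : IsBL T BL) (hg : ∃ C, ∀ x, |g x| ≤ C) :
    ∃ C, ∀ z : E N × ℝ, z.2 ∈ Icc 0 T → |value BL g z| ≤ C := by
  obtain ⟨M, hM0, hM⟩ := hBL.bounded
  obtain ⟨C, hC⟩ := hg
  refine ⟨M * T + C, fun z hz => ?_⟩
  have hne : (costs BL g z).Nonempty := costs_nonempty hBL hz
  obtain ⟨c, hc⟩ := id hne
  have hbd := fun c hc => abs_le.1 (abs_le_of_mem_costs hM0 hM hC hz (c := c) hc)
  exact abs_le.2 ⟨le_csInf hne fun c hc => (hbd c hc).1,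
    (csInf_le (bddBelow_costs hBL ⟨C, hC⟩ hz) hc).trans (hbd c hc).2⟩

/-- One half of the dynamic programming principle. -/
lemma IsArc.value_le (hBL : IsBL T BL) (hg : ∃ C, ∀ x, |g x| ≤ C) {x : E N} {t τ c : ℝ}
    {X : ℝ → E N} {L : ℝ → ℝ} (h : IsArc BL x t τ X L) (hτ0 : 0 ≤ τ) (hτt : τ ≤ t) (ht : t ≤ T)
    (hc : ∀ᵐ s ∂(volume.restrict (Ioo 0 τ)), deriv L s ≤ c) :
    value BL g (x, t) ≤ c * τ + value BL g (X τ, t - τ) := by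
  obtain ⟨M, hM0, hM⟩ := hBL.bounded
  have hz : t - τ ∈ Icc 0 T := ⟨by linarith, by linarith⟩
  have hb := h.norm_deriv_le hM hτt ht
  rw [← sub_le_iff_le_add']
  refine le_csInf (costs_nonempty (g := g) hBL (z := (X τ, t - τ)) hz) ?_
  rintro _ ⟨X₂, L₂, h₂, rfl⟩
  obtain ⟨Y, J, hYJ, hYt, hcost⟩ := h.concat hτ0 hτt hb h₂ (h₂.isArc.norm_deriv_le hM le_rfl hz.2)
  have hle : value BL g (x, t) ≤ (∫ s in (0 : ℝ)..t, deriv J s) + g (Y t) :=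
    csInf_le (bddBelow_costs (z := (x, t)) hBL hg ⟨by linarith, ht⟩) ⟨Y, J, hYJ, rfl⟩
  have hint := integral_deriv_le_of_le hτ0 hb hc
  rw [hcost, hYt] at hle
  simp only
  linarith

lemma value_zero (hBL : IsBL T BL) (hT : 0 ≤ T) (x : E N) : value BL g (x, 0) = g x := by
  have h : costs BL g (x, 0) = {g x} := by
    refine (costs_nonempty (g := g) hBL (z := (x, 0)) ⟨le_rfl, hT⟩).subset_singleton_iff.1 ?_
    rintro _ ⟨X, L, h, rfl⟩
    simp [h.start_X]
  change sInf (costs BL g (x, 0)) = g x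
  rw [h, csInf_singleton]

lemma value_le_of_small_time (hBL : IsBL T BL) (hg : ∃ C, ∀ x, |g x| ≤ C) {M : ℝ} (hM0 : 0 < M)
    (hM : ∀ x, ∀ t ∈ Ioc 0 T, ∀ b l, (b, l) ∈ BL (x, t) → ‖b‖ ≤ M ∧ |l| ≤ M)
    (x : E N) {t : ℝ} (ht : t ∈ Icc 0 T) :
    ∃ y, dist y x ≤ M * t ∧ value BL g (x, t) ≤ M * t + g y := by
  obtain ⟨X, L, h, hd⟩ := exists_trajectory hBL hM0 hM x ht
  refine ⟨X t, hd, ?_⟩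
  have hle : value BL g (x, t) ≤ (∫ s in (0 : ℝ)..t, deriv L s) + g (X t) :=
    csInf_le (bddBelow_costs (z := (x, t)) hBL hg ht) ⟨X, L, h, rfl⟩
  have := (abs_le.1 (abs_integral_deriv_le ht.1 (h.isArc.norm_deriv_le hM le_rfl ht.2))).2
  linarith

end Dynamics

/-! ### The dynamics in flat coordinates -/

section Charts

variable {N : ℕ} {T : ℝ} {BL : E N × ℝ → Set (E N × ℝ)} (S : RegularStratification N) {x : E N}

namespace RegularStratification

lemma mem_source (x : E N) : x ∈ (S.Ψ x).source := by
  rw [S.source_eq]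
  exact Metric.mem_ball_self (S.radius_pos x)

lemma hasStrictFDerivAt_chart {y : E N} (hy : y ∈ (S.Ψ x).source) :
    HasStrictFDerivAt (S.Ψ x) (fderiv ℝ (S.Ψ x) y) y :=
  ((S.contDiffOn x).contDiffAt ((S.Ψ x).open_source.mem_nhds hy)).hasStrictFDerivAt one_ne_zero

lemma hasStrictFDerivAt_symm {y : E N} (hy : y ∈ (S.Ψ x).target) :
    HasStrictFDerivAt (S.Ψ x).symm (fderiv ℝ (S.Ψ x).symm y) y :=
  ((S.contDiffOn_symm x).contDiffAt ((S.Ψ x).open_target.mem_nhds hy)).hasStrictFDerivAt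
    one_ne_zero

lemma fderiv_chart_fderiv_symm {y : E N} (hy : y ∈ (S.Ψ x).target) (b : E N) :
    fderiv ℝ (S.Ψ x) ((S.Ψ x).symm y) (fderiv ℝ (S.Ψ x).symm y b) = b := by
  have h := (S.hasStrictFDerivAt_chart ((S.Ψ x).map_target hy)).hasFDerivAt.comp y
    (S.hasStrictFDerivAt_symm hy).hasFDerivAt
  have h2 : HasFDerivAt (S.Ψ x ∘ (S.Ψ x).symm) (ContinuousLinearMap.id ℝ (E N)) y :=
    (hasFDerivAt_id y).congr_of_eventuallyEq ((S.Ψ x).eventually_right_inverse hy)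
  simpa using congrArg (fun A : E N →L[ℝ] E N => A b) (h.unique h2)

lemma fderiv_symm_fderiv_chart {y : E N} (hy : y ∈ (S.Ψ x).target) (b : E N) :
    fderiv ℝ (S.Ψ x).symm y (fderiv ℝ (S.Ψ x) ((S.Ψ x).symm y) b) = b := by
  have hy' : S.Ψ x ((S.Ψ x).symm y) = y := (S.Ψ x).right_inv hy
  have h := (hy'.symm ▸ (S.hasStrictFDerivAt_symm hy).hasFDerivAt :
      HasFDerivAt (S.Ψ x).symm (fderiv ℝ (S.Ψ x).symm y) (S.Ψ x ((S.Ψ x).symm y))).comp _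
    (S.hasStrictFDerivAt_chart ((S.Ψ x).map_target hy)).hasFDerivAt
  have h2 : HasFDerivAt ((S.Ψ x).symm ∘ S.Ψ x) (ContinuousLinearMap.id ℝ (E N)) ((S.Ψ x).symm y) :=
    (hasFDerivAt_id _).congr_of_eventuallyEq
      ((S.Ψ x).eventually_left_inverse ((S.Ψ x).map_target hy))
  simpa using congrArg (fun A : E N →L[ℝ] E N => A b) (h.unique h2)

lemma mem_flatBL {y : E N} (hy : y ∈ (S.Ψ x).target) {t : ℝ} {b : E N} {l : ℝ} :
    (b, l) ∈ S.flatBL x BL (y, t) ↔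
      (fderiv ℝ (S.Ψ x).symm y b, l) ∈ BL ((S.Ψ x).symm y, t) := by
  constructor
  · rintro ⟨⟨b', l'⟩, h, heq⟩
    simp only [Prod.mk.injEq] at heq
    rw [← heq.1, ← heq.2, S.fderiv_symm_fderiv_chart hy]
    exact h
  · intro h
    exact ⟨_, h, by simp [S.fderiv_chart_fderiv_symm hy]⟩

lemma abs_le_of_mem_flatBL {M : ℝ}
    (hM : ∀ x, ∀ t ∈ Ioc 0 T, ∀ b l, (b, l) ∈ BL (x, t) → ‖b‖ ≤ M ∧ |l| ≤ M)
    {y : E N} {t : ℝ} (ht : t ∈ Ioc 0 T) {b : E N} {l : ℝ}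
    (h : (b, l) ∈ S.flatBL x BL (y, t)) : |l| ≤ M := by
  obtain ⟨⟨b', l'⟩, h', heq⟩ := h
  simp only [Prod.mk.injEq] at heq
  rw [← heq.2]
  exact (hM _ t ht _ _ h').2

lemma isCompact_flatBL (hBL : IsBL T BL) (y : E N) {t : ℝ} (ht : t ∈ Icc 0 T) :
    IsCompact (S.flatBL x BL (y, t)) :=
  (hBL.isCompact _ t ht).image (by fun_prop)

lemma nonempty_flatBL (hBL : IsBL T BL) (y : E N) {t : ℝ} (ht : t ∈ Icc 0 T) :
    (S.flatBL x BL (y, t)).Nonempty :=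
  (hBL.nonempty _ t ht).image _

lemma convex_flatBL (hBL : IsBL T BL) (y : E N) {t : ℝ} (ht : t ∈ Icc 0 T) :
    Convex ℝ (S.flatBL x BL (y, t)) :=
  (hBL.convex _ t ht).linear_image
    ((fderiv ℝ (S.Ψ x) ((S.Ψ x).symm y)).toLinearMap.prodMap LinearMap.id)

lemma isClosed_graph_flatBL (hBL : IsBL T BL) {A : Set (E N)} (hA : IsClosed A)
    (hAt : A ⊆ (S.Ψ x).target) :
    IsClosed {p : (E N × ℝ) × (E N × ℝ) |
      p.1.1 ∈ A ∧ p.1.2 ∈ Icc 0 T ∧ p.2 ∈ S.flatBL x BL p.1} := by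
  have hcl : IsClosed {p : (E N × ℝ) × (E N × ℝ) | p.1.1 ∈ A} :=
    hA.preimage (by fun_prop)
  have h1 : ContinuousOn (fun p : (E N × ℝ) × (E N × ℝ) => (S.Ψ x).symm p.1.1)
      {p | p.1.1 ∈ A} :=
    (S.Ψ x).continuousOn_symm.comp (by fun_prop) fun p hp => hAt hp
  have h2 : ContinuousOn (fun p : (E N × ℝ) × (E N × ℝ) => fderiv ℝ (S.Ψ x).symm p.1.1)
      {p | p.1.1 ∈ A} :=
    ((S.contDiffOn_symm x).continuousOn_fderiv_of_isOpen (S.Ψ x).open_target le_rfl).comp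
      (by fun_prop) fun p hp => hAt hp
  have hf : ContinuousOn (fun p : (E N × ℝ) × (E N × ℝ) =>
      ((((S.Ψ x).symm p.1.1, p.1.2), (fderiv ℝ (S.Ψ x).symm p.1.1 p.2.1, p.2.2)) :
        (E N × ℝ) × (E N × ℝ))) {p | p.1.1 ∈ A} :=
    (h1.prodMk (by fun_prop)).prodMk ((h2.clm_apply (by fun_prop)).prodMk (by fun_prop))
  convert! hf.preimage_isClosed_of_isClosed hcl hBL.isClosed_graph using 1
  ext ⟨⟨y, t⟩, ⟨b, l⟩⟩
  simp only [mem_ofPred_eq, mem_inter_iff, mem_preimage]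
  constructor
  · rintro ⟨hy, ht, h⟩
    exact ⟨hy, ht, (S.mem_flatBL (hAt hy)).1 h⟩
  · rintro ⟨hy, ht, h⟩
    exact ⟨hy, ht, (S.mem_flatBL (hAt hy)).2 h⟩

lemma exists_lipschitzOnWith_symm (x : E N) :
    ∃ ρ > 0, ∃ K, Metric.closedBall (S.Ψ x x) ρ ⊆ (S.Ψ x).target ∧
      LipschitzOnWith K (S.Ψ x).symm (Metric.closedBall (S.Ψ x x) ρ) := by
  have hy : S.Ψ x x ∈ (S.Ψ x).target := (S.Ψ x).map_source (S.mem_source x)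
  obtain ⟨K, s, hs, hK⟩ :=
    ((S.contDiffOn_symm x).contDiffAt ((S.Ψ x).open_target.mem_nhds hy)).exists_lipschitzOnWith
  obtain ⟨ρ, hρ, hsub⟩ := Metric.nhds_basis_closedBall.mem_iff.1
    (inter_mem hs ((S.Ψ x).open_target.mem_nhds hy))
  exact ⟨ρ, hρ, K, hsub.trans inter_subset_right, hK.mono (hsub.trans inter_subset_left)⟩

/-- A solution of the inclusion in flat coordinates is carried back to an arc of the original
dynamics. -/
lemma isArc_of_flat {A : Set (E N)} {K : NNReal} (hAt : A ⊆ (S.Ψ x).target)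
    (hK : LipschitzOnWith K (S.Ψ x).symm A) {t τ : ℝ} {Y : ℝ → E N} {L : ℝ → ℝ}
    {K₁ K₂ : NNReal} (hY : LipschitzOnWith K₁ Y (Icc 0 τ)) (hL : LipschitzOnWith K₂ L (Icc 0 τ))
    (hL0 : L 0 = 0) (hYA : MapsTo Y (Icc 0 τ) A)
    (hi : ∀ᵐ s ∂(volume.restrict (Ioo 0 τ)),
      ∃ b l, (b, l) ∈ S.flatBL x BL (Y s, t - s) ∧ HasDerivAt Y b s ∧ HasDerivAt L l s) :
    IsArc BL ((S.Ψ x).symm (Y 0)) t τ (fun s => (S.Ψ x).symm (Y s)) L := by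
  refine ⟨⟨_, hK.comp hY hYA⟩, ⟨_, hL⟩, rfl, hL0, ?_⟩
  filter_upwards [hi, ae_restrict_mem measurableSet_Ioo] with s ⟨b, l, hbl, hYd, hLd⟩ hs
  have hy := hAt (hYA (Ioo_subset_Icc_self hs))
  exact ⟨_, l, (S.mem_flatBL hy).1 hbl,
    (S.hasStrictFDerivAt_symm hy).hasFDerivAt.comp_hasDerivAt s hYd, hLd⟩

end RegularStratification

lemma IsFlatAt.mem_iff {Ω : Set (E N)} {A : Fin (N + 1) → Set (E N)} {k : Fin (N + 1)}
    {y z : E N} {r : ℝ} {V : Submodule ℝ (E N)} (h : IsFlatAt Ω A k y r V)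
    (hz : z ∈ Metric.ball y r) : z ∈ A k ↔ z - y ∈ V := by
  have : z ∈ Metric.ball y r ∩ A k ↔ z ∈ Metric.ball y r ∩ {z | z - y ∈ V} := by rw [h.inter_eq]
  simpa [hz] using this

lemma exists_small_smul (v : E N) {r : ℝ} (hr : 0 < r) : ∃ a : ℝ, 0 < a ∧ ‖a • v‖ < r := by
  refine ⟨r / (‖v‖ + 1), by positivity, ?_⟩
  rw [norm_smul, Real.norm_eq_abs, abs_of_pos (by positivity), div_mul_eq_mul_div,
    div_lt_iff₀ (by positivity)]
  nlinarith [norm_nonneg v]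

/-- The direction of the affine space which a flat stratum coincides with is determined. -/
lemma IsFlatAt.subspace_unique {Ω : Set (E N)} {A : Fin (N + 1) → Set (E N)} {k : Fin (N + 1)}
    {y : E N} {r₁ r₂ : ℝ} {V₁ V₂ : Submodule ℝ (E N)} (h₁ : IsFlatAt Ω A k y r₁ V₁)
    (h₂ : IsFlatAt Ω A k y r₂ V₂) : V₁ = V₂ := by
  have hle : V₁ ≤ V₂ := fun v hv => by
    obtain ⟨a, ha, hav⟩ := exists_small_smul v (lt_min h₁.pos h₂.pos)
    have hz₁ : y + a • v ∈ Metric.ball y r₁ := by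
      simpa [Metric.mem_ball, dist_eq_norm] using hav.trans_le (min_le_left _ _)
    have hz₂ : y + a • v ∈ Metric.ball y r₂ := by
      simpa [Metric.mem_ball, dist_eq_norm] using hav.trans_le (min_le_right _ _)
    have := (h₂.mem_iff hz₂).1 ((h₁.mem_iff hz₁).2 (by simpa using V₁.smul_mem a hv))
    rw [add_sub_cancel_left] at this
    exact (V₂.smul_mem_iff ha.ne').1 this
  exact Submodule.eq_of_le_of_finrank_eq hle (h₁.finrank_eq.trans h₂.finrank_eq.symm)

namespace RegularStratification

lemma symm_mem_stratum {k : Fin (N + 1)} {y : E N} (h : y ∈ S.flatM x k) :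
    (S.Ψ x).symm y ∈ S.M k := by
  obtain ⟨z, hz, rfl⟩ := h
  rw [(S.Ψ x).left_inv hz.2]
  exact hz.1

lemma mem_flatM {k : Fin (N + 1)} {z : E N} (hz : z ∈ S.M k) (hzs : z ∈ (S.Ψ x).source) :
    S.Ψ x z ∈ S.flatM x k := ⟨z, ⟨hz, hzs⟩, rfl⟩

/-- A velocity tangent to a stratum is tangent to the flat model in the chart. -/
lemma fderiv_chart_mem {k : Fin (N + 1)} {r : ℝ} {V : Submodule ℝ (E N)}
    (hflat : IsFlatAt (S.Ψ x).target (S.flatM x) k (S.Ψ x x) r V) {b : E N}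
    (hb : b ∈ tangentSpaceAt (S.M k) x) : fderiv ℝ (S.Ψ x) x b ∈ V := by
  obtain ⟨γ, hγ, rfl, hγd⟩ := hb
  set x := γ 0
  have hd : HasDerivAt (fun s => S.Ψ x (γ s)) (fderiv ℝ (S.Ψ x) x b) 0 :=
    (S.hasStrictFDerivAt_chart (S.mem_source x)).hasFDerivAt.comp_hasDerivAt 0 hγd
  have hsrc : ∀ᶠ s in 𝓝 0, γ s ∈ (S.Ψ x).source :=
    hγd.continuousAt.eventually ((S.Ψ x).open_source.mem_nhds (S.mem_source x))
  have hball : ∀ᶠ s in 𝓝 0, S.Ψ x (γ s) ∈ Metric.ball (S.Ψ x x) r :=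
    hd.continuousAt.eventually (Metric.ball_mem_nhds _ hflat.pos)
  have hslope : Tendsto (fun s : ℝ => s⁻¹ • (S.Ψ x (γ (0 + s)) - S.Ψ x (γ 0))) (𝓝[>] 0)
      (𝓝 (fderiv ℝ (S.Ψ x) x b)) := hd.tendsto_slope_zero_right
  refine V.closed_of_finiteDimensional.mem_of_tendsto hslope ?_
  refine ((hγ.and (hsrc.and hball)).filter_mono nhdsWithin_le_nhds).mono fun s hs => ?_
  rw [zero_add]
  exact V.smul_mem _ ((hflat.mem_iff hs.2.2).1 (S.mem_flatM hs.1 hs.2.1))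

end RegularStratification

end Charts

/-! ### Reaching the stratum along its normal directions -/

section Normal

variable {N : ℕ} {T : ℝ} {BL : E N × ℝ → Set (E N × ℝ)} {S : RegularStratification N} {x : E N}
  {g : E N → ℝ}

/-- By normal controllability, the stratum is reached in flat coordinates along a straight line
orthogonal to it, at speed `δ / 2`. -/
lemma value_le_value_normal_proj (hBL : IsBL T BL) (hg : ∃ C, ∀ x, |g x| ≤ C) {M : ℝ}
    (hM : ∀ x, ∀ t ∈ Ioc 0 T, ∀ b l, (b, l) ∈ BL (x, t) → ‖b‖ ≤ M ∧ |l| ≤ M)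
    {k : Fin (N + 1)} {r δ ρ : ℝ} {V : Submodule ℝ (E N)}
    (hflat : IsFlatAt (S.Ψ x).target (S.flatM x) k (S.Ψ x x) r V) (hδ : 0 < δ)
    (hNC : ∀ t ∈ Icc 0 T, ∀ y ∈ Metric.ball (S.Ψ x x) r \ S.flatM x k,
      Metric.ball 0 δ ∩ (Vᗮ : Set (E N)) ⊆
        Prod.fst '' S.flatBL x BL (y, t) ∩ (Vᗮ : Set (E N)))
    (hρr : ρ < r) {K : NNReal} (hρ : Metric.closedBall (S.Ψ x x) ρ ⊆ (S.Ψ x).target)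
    (hK : LipschitzOnWith K (S.Ψ x).symm (Metric.closedBall (S.Ψ x x) ρ))
    {y w : E N} (hy : y ∈ Metric.closedBall (S.Ψ x x) ρ)
    (hw : w = Vᗮ.starProjection (y - S.Ψ x x)) {t τ : ℝ} (hτ : τ = 2 * ‖w‖ / δ) (hτt : τ ≤ t)
    (ht : t ≤ T) :
    value BL g ((S.Ψ x).symm y, t) ≤ M * τ + value BL g ((S.Ψ x).symm (y - w), t - τ) := by
  set y₀ := S.Ψ x x
  rcases eq_or_ne w 0 with rfl | hw0
  · simp [hτ]
  have hwpos : 0 < ‖w‖ := norm_pos_iff.2 hw0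
  have hτ0 : 0 < τ := by rw [hτ]; positivity
  have hwV : w ∈ Vᗮ := by rw [hw]; exact Submodule.starProjection_apply_mem _ _
  have hvV : y - y₀ - w ∈ V := by
    rw [hw, Submodule.starProjection_orthogonal_val, sub_sub_cancel]
    exact Submodule.starProjection_apply_mem _ _
  have hvn : ‖y - y₀ - w‖ ≤ ρ := by
    rw [hw, Submodule.starProjection_orthogonal_val, sub_sub_cancel]
    exact (Submodule.norm_starProjection_apply_le V _).trans
      (by simpa [dist_eq_norm] using hy)
  set c : E N := -(τ⁻¹ • w) with hc
  have hcV : c ∈ Vᗮ := Vᗮ.neg_mem (Vᗮ.smul_mem _ hwV)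
  have hcδ : ‖c‖ < δ := by
    rw [hc, norm_neg, norm_smul, norm_inv, Real.norm_eq_abs, abs_of_pos hτ0, hτ]
    field_simp
    norm_num
  have hline : ∀ s, y + s • c - y₀ = (y - y₀ - w) + (1 - s / τ) • w := fun s => by
    rw [hc, smul_neg, smul_smul, sub_smul, one_smul, div_eq_mul_inv]
    abel
  have hball : ∀ s ∈ Icc 0 τ, y + s • c ∈ Metric.closedBall y₀ ρ := fun s hs => by
    rw [mem_closedBall_iff_norm, hline]
    have hθ0 : 0 ≤ s / τ := div_nonneg hs.1 hτ0.le
    have hθ1 : s / τ ≤ 1 := div_le_one_of_le₀ hs.2 hτ0.le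
    have : (y - y₀ - w) + (1 - s / τ) • w = (s / τ) • (y - y₀ - w) + (1 - s / τ) • (y - y₀) := by
      module
    rw [this]
    refine (norm_add_le _ _).trans ?_
    rw [norm_smul, norm_smul, Real.norm_of_nonneg hθ0, Real.norm_of_nonneg (sub_nonneg.2 hθ1)]
    have hyn : ‖y - y₀‖ ≤ ρ := by simpa [dist_eq_norm] using hy
    nlinarith
  have hout : ∀ s ∈ Ico 0 τ, y + s • c ∈ Metric.ball y₀ r \ S.flatM x k := fun s hs => by
    have hb : y + s • c ∈ Metric.ball y₀ r :=
      Metric.closedBall_subset_ball hρr (hball s (Ico_subset_Icc_self hs))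
    refine ⟨hb, fun hmem => hw0 ?_⟩
    have h1 := (hflat.mem_iff hb).1 hmem
    rw [hline] at h1
    have h2 : (1 - s / τ) • w ∈ V := (V.add_mem_iff_right hvV).1 h1
    have h3 : 0 < 1 - s / τ := sub_pos.2 ((div_lt_one hτ0).2 hs.2)
    have h4 : w ∈ V := (V.smul_mem_iff h3.ne').1 h2
    exact inner_self_eq_zero.1 (Submodule.inner_right_of_mem_orthogonal h4 hwV)
  have hM0 : 0 ≤ M := by
    obtain ⟨p, hp⟩ := hBL.nonempty x t ⟨by linarith, ht⟩
    exact (abs_nonneg _).trans (hM x t ⟨by linarith, ht⟩ p.1 p.2 hp).2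
  obtain ⟨L, hL0, hL, hLd⟩ := exists_solution (W := ℝ) (w₀ := 0) (K := univ) (C := Icc (-M) M)
    (F := fun _ s => {l | (c, l) ∈ S.flatBL x BL (y + s • c, t - s)}) hτ0
    isCompact_Icc (convex_Icc _ _) ⟨0, by simpa using hM0⟩ (fun _ _ _ _ => mem_univ _)
    (fun _ _ s hs => by
      have hts : t - s ∈ Ioc 0 T := ⟨by linarith [hs.2], by linarith [hs.1]⟩
      obtain ⟨⟨⟨c', l⟩, hl, rfl : c' = c⟩, -⟩ := hNC (t - s) (Ioc_subset_Icc_self hts) _ (hout s hs)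
        ⟨by simpa using hcδ, hcV⟩
      exact ⟨l, hl, abs_le.1 (S.abs_le_of_mem_flatBL hM hts hl)⟩)
    (fun _ _ s hs l₁ h₁ l₂ h₂ a b ha hb hab => by
      have hts : t - s ∈ Icc 0 T := ⟨by linarith [hs.2], by linarith [hs.1]⟩
      have := S.convex_flatBL (x := x) hBL (y + s • c) hts h₁ h₂ ha hb hab
      simpa [← add_smul, hab] using this)
    (by
      have hcl := S.isClosed_graph_flatBL (x := x) hBL Metric.isClosed_closedBall hρ
      convert! (isClosed_Icc.preimage (t := Icc 0 τ) (f := fun p : ℝ × ℝ × ℝ => p.2.1)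
        (by fun_prop)).inter (hcl.preimage
          (f := fun p : ℝ × ℝ × ℝ => ((y + p.2.1 • c, t - p.2.1), (c, p.2.2))) (by fun_prop)) using 1
      ext ⟨a, s, l⟩
      simp only [mem_univ, true_and, mem_inter_iff, mem_ofPred_eq, mem_preimage]
      constructor
      · rintro ⟨h1, h2⟩
        exact ⟨h1, hball s h1, ⟨by linarith [h1.2], by linarith [h1.1]⟩, h2⟩
      · rintro ⟨h1, -, -, h2⟩
        exact ⟨h1, h2⟩)
  have hLlip := lipschitzOnWith_Icc_of_increment (M := M)
    (fun l hl => by simpa [abs_le] using hl) hL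
  have hYlip : LipschitzWith ‖c‖₊ fun s : ℝ => y + s • c := LipschitzWith.of_dist_le_mul fun a b => by
    rw [dist_add_left, dist_eq_norm, ← sub_smul, norm_smul, mul_comm, coe_nnnorm, dist_eq_norm]
  have harc := S.isArc_of_flat (BL := BL) (t := t) hρ hK hYlip.lipschitzOnWith hLlip hL0 hball (by
    filter_upwards [hLd] with s ⟨l, hl, hd⟩
    refine ⟨c, l, hl, ?_, hd⟩
    simpa using ((hasDerivAt_id s).smul_const c).const_add y)
  have hend : y + τ • c = y - w := by
    rw [hc, smul_neg, smul_smul, mul_inv_cancel₀ hτ0.ne', one_smul, sub_eq_add_neg]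
  have := harc.value_le (g := g) (c := M) hBL hg hτ0.le hτt ht (by
    filter_upwards [harc.norm_deriv_le hM hτt ht] with s hs using (le_abs_self _).trans hs)
  simpa [hend] using this

end Normal

/-! ### Upper semicontinuous envelopes -/

section Envelopes

variable {N : ℕ} {D D' : Set (E N × ℝ)} {u : E N × ℝ → ℝ} {C : ℝ}

lemma isBoundedUnder_le_of_bound (hC : ∀ z ∈ D, |u z| ≤ C) (z : E N × ℝ) :
    (𝓝[D] z).IsBoundedUnder (· ≤ ·) u :=
  isBoundedUnder_of_eventually_le (a := C)
    (eventually_nhdsWithin_of_forall fun z hz => (abs_le.1 (hC z hz)).2)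

lemma isCoboundedUnder_le_of_bound (hC : ∀ z ∈ D, |u z| ≤ C) {z : E N × ℝ} (hz : z ∈ D) :
    (𝓝[D] z).IsCoboundedUnder (· ≤ ·) u := by
  have : (𝓝[D] z).NeBot := mem_closure_iff_nhdsWithin_neBot.1 (subset_closure hz)
  exact IsBoundedUnder.isCoboundedUnder_le (isBoundedUnder_of_eventually_ge (a := -C)
    (eventually_nhdsWithin_of_forall fun z hz => (abs_le.1 (hC z hz)).1))

lemma le_uscEnvelope (hC : ∀ z ∈ D, |u z| ≤ C) {z : E N × ℝ} (hz : z ∈ D) :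
    u z ≤ uscEnvelope D u z := by
  refine le_limsup_of_frequently_le ?_ (isBoundedUnder_le_of_bound hC z)
  intro h
  exact h.self_of_nhdsWithin hz le_rfl

lemma uscEnvelope_mono (hC : ∀ z ∈ D, |u z| ≤ C) (hD : D' ⊆ D) {z : E N × ℝ} (hz : z ∈ D') :
    uscEnvelope D' u z ≤ uscEnvelope D u z :=
  limsup_le_limsup_of_le (nhdsWithin_mono z hD)
    (isCoboundedUnder_le_of_bound (fun z hz => hC z (hD hz)) hz) (isBoundedUnder_le_of_bound hC z)

end Envelopes

section NormalEnvelope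

variable {N : ℕ} {T : ℝ} {BL : E N × ℝ → Set (E N × ℝ)} {S : RegularStratification N}
  {g : E N → ℝ}

lemma uscEnvelope_value_zero_le (hT : 0 < T) (hBL : IsBL T BL) (hgb : ∃ C, ∀ x, |g x| ≤ C)
    (hg : UniformContinuous g) (x : E N) :
    uscEnvelope (univ ×ˢ Icc (0 : ℝ) T) (value BL g) (x, 0) ≤ g x := by
  obtain ⟨M, hM0, hM⟩ := hBL.bounded
  obtain ⟨C, hC⟩ := exists_abs_value_le (g := g) hBL hgb
  refine le_of_forall_pos_le_add fun ε hε => ?_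
  refine limsup_le_of_le (isCoboundedUnder_le_of_bound (fun z hz => hC z hz.2)
    ⟨mem_univ _, le_rfl, hT.le⟩) ?_
  obtain ⟨η, hη, hgη⟩ := Metric.continuousAt_iff.1 (hg.continuous.continuousAt (x := x)) (ε / 2)
    (by positivity)
  have h1 : ∀ᶠ z : E N × ℝ in 𝓝 (x, 0), dist z.1 x < η / 2 :=
    (continuous_fst.tendsto (x, (0 : ℝ))).eventually (Metric.ball_mem_nhds _ (by positivity))
  have h2 : ∀ᶠ z : E N × ℝ in 𝓝 (x, 0), M * z.2 < min (ε / 2) (η / 2) := by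
    have : Tendsto (fun z : E N × ℝ => M * z.2) (𝓝 (x, 0)) (𝓝 (M * 0)) :=
      (continuous_snd.tendsto (x, (0 : ℝ))).const_mul M
    rw [mul_zero] at this
    exact this.eventually_lt_const (by positivity)
  filter_upwards [nhdsWithin_le_nhds h1, nhdsWithin_le_nhds h2, self_mem_nhdsWithin] with z hz1 hz2 hz
  obtain ⟨y, hy, hle⟩ := value_le_of_small_time hBL hgb hM0 hM z.1 hz.2
  have hyx : dist y x < η := by
    linarith [dist_triangle y z.1 x, hz2.trans_le (min_le_right _ _)]
  have := (abs_lt.1 (Real.dist_eq (g y) (g x) ▸ hgη hyx)).2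
  linarith [hz2.trans_le (min_le_left _ _)]

/-- The envelope of the value function at a point of a stratum is determined by its values on the
stratum. -/
theorem uscEnvelope_value_eq (hT : 0 < T) (hBL : IsBL T BL) (hgb : ∃ C, ∀ x, |g x| ≤ C)
    (hg : UniformContinuous g) (hNC : NormalControllability T BL S) {k : Fin (N + 1)}
    (hk : (k : ℕ) < N) {z : E N × ℝ} (hz : z ∈ S.M k ×ˢ Icc (0 : ℝ) T) :
    uscEnvelope (univ ×ˢ Icc (0 : ℝ) T) (value BL g) z =
      uscEnvelope (S.M k ×ˢ Icc (0 : ℝ) T) (value BL g) z := by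
  obtain ⟨C, hC⟩ := exists_abs_value_le (g := g) hBL hgb
  have hCD : ∀ z ∈ (univ : Set (E N)) ×ˢ Icc (0 : ℝ) T, |value BL g z| ≤ C := fun z hz => hC z hz.2
  have hCk : ∀ z ∈ S.M k ×ˢ Icc (0 : ℝ) T, |value BL g z| ≤ C := fun z hz => hC z hz.2
  have hDk : S.M k ×ˢ Icc (0 : ℝ) T ⊆ univ ×ˢ Icc (0 : ℝ) T := prod_mono (subset_univ _) le_rfl
  refine le_antisymm ?_ (uscEnvelope_mono hCD hDk hz)
  obtain ⟨x, t⟩ := z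
  obtain ⟨hx : x ∈ S.M k, ht : t ∈ Icc 0 T⟩ := hz
  rcases ht.1.eq_or_lt with rfl | ht0
  · refine (uscEnvelope_value_zero_le hT hBL hgb hg x).trans ?_
    rw [← value_zero (g := g) hBL hT.le x]
    exact le_uscEnvelope hCk ⟨hx, ht⟩
  obtain ⟨M, hM0, hM⟩ := hBL.bounded
  obtain ⟨r, V, hflat, δ, hδ, hδNC⟩ := hNC k hk x hx
  obtain ⟨ρ₀, hρ₀, K, hρt, hK⟩ := S.exists_lipschitzOnWith_symm x
  set ρ := min ρ₀ (r / 2)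
  have hr := hflat.pos
  have hρ : 0 < ρ := by positivity
  have hρr : ρ < r := (min_le_right _ _).trans_lt (by linarith)
  have hsub : Metric.closedBall (S.Ψ x x) ρ ⊆ Metric.closedBall (S.Ψ x x) ρ₀ :=
    Metric.closedBall_subset_closedBall (min_le_left _ _)
  let w : E N × ℝ → E N := fun z => Vᗮ.starProjection (S.Ψ x z.1 - S.Ψ x x)
  let τ : E N × ℝ → ℝ := fun z => 2 * ‖w z‖ / δ
  let ζ : E N × ℝ → E N × ℝ := fun z => ((S.Ψ x).symm (S.Ψ x z.1 - w z), z.2 - τ z)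
  have hΨ : Tendsto (fun z : E N × ℝ => S.Ψ x z.1) (𝓝 (x, t)) (𝓝 (S.Ψ x x)) :=
    ((S.Ψ x).continuousAt (S.mem_source x)).tendsto.comp (continuous_fst.tendsto (x, t))
  have hw : Tendsto w (𝓝 (x, t)) (𝓝 0) := by
    have := ((Vᗮ.starProjection).continuous.tendsto _).comp (hΨ.sub_const (S.Ψ x x))
    rw [sub_self, map_zero] at this
    exact this
  have hτ : Tendsto τ (𝓝 (x, t)) (𝓝 0) := by
    simpa [τ] using (hw.norm.const_mul 2).div_const δ
  have hyw : Tendsto (fun z => S.Ψ x z.1 - w z) (𝓝 (x, t)) (𝓝 (S.Ψ x x)) := by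
    simpa using hΨ.sub hw
  have hζ : Tendsto ζ (𝓝 (x, t)) (𝓝 (x, t)) := by
    have h1 := (((S.Ψ x).symm.continuousAt ((S.Ψ x).map_source (S.mem_source x))).tendsto).comp hyw
    rw [(S.Ψ x).left_inv (S.mem_source x)] at h1
    have h2 : Tendsto (fun z => z.2 - τ z) (𝓝 (x, t)) (𝓝 t) := by
      simpa using (continuous_snd.tendsto (x, t)).sub hτ
    exact h1.prodMk_nhds h2
  have hτt : ∀ᶠ z in 𝓝 (x, t), τ z ≤ z.2 := by
    have : Tendsto (fun z => z.2 - τ z) (𝓝 (x, t)) (𝓝 t) := by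
      simpa using (continuous_snd.tendsto (x, t)).sub hτ
    filter_upwards [this.eventually_const_lt ht0] with z hz
    linarith
  have hball : ∀ᶠ z : E N × ℝ in 𝓝 (x, t), S.Ψ x z.1 ∈ Metric.closedBall (S.Ψ x x) ρ :=
    hΨ.eventually (Metric.closedBall_mem_nhds _ hρ)
  have hball' : ∀ᶠ z : E N × ℝ in 𝓝 (x, t), S.Ψ x z.1 - w z ∈ Metric.ball (S.Ψ x x) r :=
    hyw.eventually (Metric.ball_mem_nhds _ hr)
  have hsrc : ∀ᶠ z : E N × ℝ in 𝓝 (x, t), z.1 ∈ (S.Ψ x).source :=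
    (continuous_fst.tendsto (x, t)).eventually ((S.Ψ x).open_source.mem_nhds (S.mem_source x))
  have hζk : Tendsto ζ (𝓝[univ ×ˢ Icc (0 : ℝ) T] (x, t)) (𝓝[S.M k ×ˢ Icc (0 : ℝ) T] (x, t)) := by
    refine tendsto_nhdsWithin_iff.2 ⟨hζ.mono_left nhdsWithin_le_nhds, ?_⟩
    filter_upwards [nhdsWithin_le_nhds hτt, nhdsWithin_le_nhds hball', self_mem_nhdsWithin] with
      z h1 h2 h3
    have hτ0 : 0 ≤ τ z := by positivity
    refine ⟨S.symm_mem_stratum ((hflat.mem_iff h2).2 ?_), ⟨by simp only [ζ]; linarith,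
      by simp only [ζ]; linarith [h3.2.2]⟩⟩
    have : S.Ψ x z.1 - w z - S.Ψ x x = V.starProjection (S.Ψ x z.1 - S.Ψ x x) := by
      simp only [w]
      rw [Submodule.starProjection_orthogonal_val]
      abel
    rw [this]
    exact Submodule.starProjection_apply_mem _ _
  refine le_of_forall_pos_le_add fun ε hε => ?_
  refine limsup_le_of_le (isCoboundedUnder_le_of_bound hCD ⟨mem_univ _, ht⟩) ?_
  have hlim : ∀ᶠ z' in 𝓝[S.M k ×ˢ Icc (0 : ℝ) T] (x, t),
      value BL g z' < uscEnvelope (S.M k ×ˢ Icc (0 : ℝ) T) (value BL g) (x, t) + ε / 2 :=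
    eventually_lt_of_limsup_lt (lt_add_of_pos_right _ (by positivity))
      (isBoundedUnder_le_of_bound hCk _)
  have hMτ : ∀ᶠ z in 𝓝 (x, t), M * τ z < ε / 2 := by
    have := hτ.const_mul M
    rw [mul_zero] at this
    exact this.eventually_lt_const (by positivity)
  filter_upwards [hζk.eventually hlim, nhdsWithin_le_nhds hMτ, nhdsWithin_le_nhds hτt,
    nhdsWithin_le_nhds hball, nhdsWithin_le_nhds hsrc, self_mem_nhdsWithin] with z h1 h2 h3 h4 h5 h6
  have := value_le_value_normal_proj (g := g) hBL hgb hM hflat hδ hδNC hρr (hsub.trans hρt)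
    (hK.mono hsub) h4 (w := w z) rfl (τ := τ z) rfl h3 h6.2.2
  rw [(S.Ψ x).left_inv h5] at this
  simp only [ζ] at h1
  linarith

end NormalEnvelope

/-! ### Tangential trajectories on a stratum -/

section Tangential

variable {N : ℕ} {T : ℝ} {BL : E N × ℝ → Set (E N × ℝ)} {S : RegularStratification N} {x : E N}
  {g : E N → ℝ}

/-- Normal controllability extends to the points of the stratum itself, which are limits of points
outside it because `k < N`. -/
lemma exists_mem_flatBL_orthogonal (hBL : IsBL T BL) {M : ℝ}
    (hM : ∀ x, ∀ t ∈ Ioc 0 T, ∀ b l, (b, l) ∈ BL (x, t) → ‖b‖ ≤ M ∧ |l| ≤ M)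
    {k : Fin (N + 1)} (hk : (k : ℕ) < N) {r δ ρ : ℝ} {V : Submodule ℝ (E N)}
    (hflat : IsFlatAt (S.Ψ x).target (S.flatM x) k (S.Ψ x x) r V)
    (hNC : ∀ t ∈ Icc 0 T, ∀ y ∈ Metric.ball (S.Ψ x x) r \ S.flatM x k,
      Metric.ball 0 δ ∩ (Vᗮ : Set (E N)) ⊆
        Prod.fst '' S.flatBL x BL (y, t) ∩ (Vᗮ : Set (E N)))
    (hρr : ρ ≤ r) (hρ : Metric.closedBall (S.Ψ x x) ρ ⊆ (S.Ψ x).target)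
    {y : E N} (hy : y ∈ Metric.ball (S.Ψ x x) ρ) {t : ℝ} (ht : t ∈ Ioc 0 T) {c : E N}
    (hcV : c ∈ Vᗮ) (hcδ : ‖c‖ < δ) :
    ∃ l, (c, l) ∈ S.flatBL x BL (y, t) := by
  have hmem : ∀ z ∈ Metric.ball (S.Ψ x x) ρ, z - S.Ψ x x ∉ V →
      ∃ l, (c, l) ∈ S.flatBL x BL (z, t) := fun z hz hzV => by
    have hz' := Metric.ball_subset_ball hρr hz
    obtain ⟨⟨⟨c', l⟩, hl, rfl : c' = c⟩, -⟩ := hNC t (Ioc_subset_Icc_self ht) z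
      ⟨hz', fun h => hzV ((hflat.mem_iff hz').1 h)⟩ ⟨by simpa using hcδ, hcV⟩
    exact ⟨l, hl⟩
  by_cases hyV : y - S.Ψ x x ∈ V
  swap
  · exact hmem y hy hyV
  have hVtop : V ≠ ⊤ := fun h => by
    have := hflat.finrank_eq
    rw [h, finrank_top, finrank_euclideanSpace, Fintype.card_fin] at this
    omega
  obtain ⟨e, he⟩ : ∃ e, e ∉ V := by
    by_contra! h
    exact hVtop ((Submodule.eq_top_iff').2 h)
  have hlim : Tendsto (fun n : ℕ => y + (1 / ((n : ℝ) + 1)) • e) atTop (𝓝 y) := by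
    simpa using ((tendsto_one_div_add_atTop_nhds_zero_nat (𝕜 := ℝ)).smul_const e).const_add y
  have hout : ∀ n : ℕ, y + (1 / ((n : ℝ) + 1)) • e - S.Ψ x x ∉ V := fun n h => by
    rw [add_sub_right_comm, V.add_mem_iff_right hyV, V.smul_mem_iff (by positivity)] at h
    exact he h
  have hev : ∀ᶠ n : ℕ in atTop, ∃ l, (c, l) ∈ S.flatBL x BL (y + (1 / ((n : ℝ) + 1)) • e, t) ∧
      y + (1 / ((n : ℝ) + 1)) • e ∈ Metric.ball (S.Ψ x x) ρ := by
    filter_upwards [hlim.eventually (Metric.isOpen_ball.mem_nhds hy)] with n hn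
    obtain ⟨l, hl⟩ := hmem _ hn (hout n)
    exact ⟨l, hl, hn⟩
  obtain ⟨n₀, hn₀⟩ := eventually_atTop.1 hev
  choose! l hl hlb using hn₀
  obtain ⟨l', -, ψ, hψ, hlim'⟩ := isCompact_Icc.tendsto_subseq (x := fun n => l (n + n₀))
    (s := Icc (-M) M) fun n => abs_le.1 (S.abs_le_of_mem_flatBL hM ht (hl _ (Nat.le_add_left _ _)))
  have hlimψ := (hlim.comp (tendsto_add_atTop_nat n₀)).comp hψ.tendsto_atTop
  refine ⟨l', ((S.isClosed_graph_flatBL (x := x) hBL Metric.isClosed_closedBall hρ).mem_of_tendsto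
    ((hlimψ.prodMk_nhds tendsto_const_nhds).prodMk_nhds
      (tendsto_const_nhds.prodMk_nhds hlim')) (.of_forall fun n => ?_)).2.2⟩
  exact ⟨Metric.ball_subset_closedBall (hlb _ (Nat.le_add_left _ _)), Ioc_subset_Icc_self ht,
    hl _ (Nat.le_add_left _ _)⟩

/-- The tangential part of the flat dynamics is lower semicontinuous along the stratum. Tangential
continuity provides a nearby velocity with a small normal component, which is cancelled by a convex
combination with a normal velocity given by normal controllability. -/
lemma exists_tangential_near (hBL : IsBL T BL) {M : ℝ} (hM0 : 0 < M)
    (hM : ∀ x, ∀ t ∈ Ioc 0 T, ∀ b l, (b, l) ∈ BL (x, t) → ‖b‖ ≤ M ∧ |l| ≤ M)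
    {k : Fin (N + 1)} {r δ ρ : ℝ} {V : Submodule ℝ (E N)}
    (hflat : IsFlatAt (S.Ψ x).target (S.flatM x) k (S.Ψ x x) r V) (hδ : 0 < δ) (hρ : 0 < ρ)
    (hnormal : ∀ y ∈ Metric.ball (S.Ψ x x) ρ, ∀ t ∈ Ioc 0 T, ∀ c ∈ Vᗮ, ‖c‖ < δ →
      ∃ l, (c, l) ∈ S.flatBL x BL (y, t))
    {m : ℝ → ℝ} (hm : Tendsto m (𝓝[>] 0) (𝓝 0))
    (hTC : ∀ y₁ ∈ S.flatM x k ∩ Metric.ball (S.Ψ x x) r,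
      ∀ y₂ ∈ S.flatM x k ∩ Metric.ball (S.Ψ x x) r, y₁ - y₂ ∈ V →
      ∀ t ∈ Icc 0 T, ∀ t' ∈ Icc 0 T,
        Metric.hausdorffDist (S.flatBL x BL (y₁, t)) (S.flatBL x BL (y₂, t')) ≤
          m (‖y₁ - y₂‖ + |t - t'|))
    {t₀ : ℝ} (ht₀ : t₀ ∈ Ioc 0 T) {b : E N} {l : ℝ} (hbV : b ∈ V)
    (hbl : (b, l) ∈ S.flatBL x BL (S.Ψ x x, t₀)) {ε : ℝ} (hε : 0 < ε) :
    ∃ η > 0, ∀ v ∈ V, ‖v‖ < η → ∀ s ∈ Ioc 0 T, |s - t₀| < η →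
      ∃ b' ∈ V, ∃ l', (b', l') ∈ S.flatBL x BL (S.Ψ x x + v, s) ∧ ‖b' - b‖ ≤ ε ∧ |l' - l| ≤ ε := by
  set y₀ := S.Ψ x x
  set B : ℝ := δ + ‖b‖ + 2 * M
  have hB0 : 0 < B := by positivity
  -- `1 / (1 + κ)` is the weight of the normal velocity in the convex combination
  set κ : ℝ := 2 * B / ε with hκ
  have hκ0 : 0 < κ := by positivity
  set ε' : ℝ := min (ε / 2) (δ / (2 * κ))
  have hε'0 : 0 < ε' := by positivity
  obtain ⟨η₀, hη₀, hmη⟩ := mem_nhdsGT_iff_exists_Ioo_subset.1 (hm.eventually_lt_const hε'0)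
  have hr := hflat.pos
  have hη₀' : 0 < η₀ := hη₀
  refine ⟨min (η₀ / 2) (min r ρ), by positivity, fun v hv hvη s hs hsη => ?_⟩
  have hv1 : ‖v‖ < η₀ / 2 := hvη.trans_le (min_le_left _ _)
  have hv2 : ‖v‖ < r := hvη.trans_le ((min_le_right _ _).trans (min_le_left _ _))
  have hv3 : ‖v‖ < ρ := hvη.trans_le ((min_le_right _ _).trans (min_le_right _ _))
  have hs1 : |s - t₀| < η₀ / 2 := hsη.trans_le (min_le_left _ _)
  have hmemball : ∀ v ∈ V, ‖v‖ < r → y₀ + v ∈ S.flatM x k ∩ Metric.ball y₀ r := fun v hv hvr => by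
    have hb : y₀ + v ∈ Metric.ball y₀ r := by simpa [Metric.mem_ball, dist_eq_norm] using hvr
    exact ⟨(hflat.mem_iff hb).2 (by simpa using hv), hb⟩
  rcases (add_nonneg (norm_nonneg v) (abs_nonneg (s - t₀))).eq_or_lt with h0 | hpos
  · have hv0 : v = 0 := norm_eq_zero.1 (by linarith [norm_nonneg v, abs_nonneg (s - t₀)])
    have hs0 : s = t₀ := by
      have : |s - t₀| = 0 := by linarith [norm_nonneg v, abs_nonneg (s - t₀)]
      exact sub_eq_zero.1 (abs_eq_zero.1 this)
    subst hv0 hs0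
    exact ⟨b, hbV, l, by simpa using hbl, by simpa using hε.le, by simpa using hε.le⟩
  have hH : Metric.hausdorffDist (S.flatBL x BL (y₀, t₀)) (S.flatBL x BL (y₀ + v, s)) < ε' := by
    have h1 := hTC y₀ (by simpa using hmemball 0 V.zero_mem (by simpa using hr)) (y₀ + v)
      (hmemball v hv hv2) (by simpa using hv) t₀ (Ioc_subset_Icc_self ht₀) s (Ioc_subset_Icc_self hs)
    rw [sub_add_cancel_left, norm_neg, abs_sub_comm] at h1
    exact h1.trans_lt (hmη ⟨hpos, by linarith⟩)
  have hc₀ := S.isCompact_flatBL (x := x) hBL y₀ (Ioc_subset_Icc_self ht₀)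
  have hcs := S.isCompact_flatBL (x := x) hBL (y₀ + v) (Ioc_subset_Icc_self hs)
  obtain ⟨⟨b₁, l₁⟩, h₁, hd⟩ := Metric.exists_dist_lt_of_hausdorffDist_lt hbl hH
    (Metric.hausdorffEDist_ne_top_of_nonempty_of_bounded
      (S.nonempty_flatBL hBL y₀ (Ioc_subset_Icc_self ht₀))
      (S.nonempty_flatBL hBL (y₀ + v) (Ioc_subset_Icc_self hs)) hc₀.isBounded hcs.isBounded)
  rw [Prod.dist_eq, max_lt_iff] at hd
  have hdb : ‖b₁ - b‖ < ε' := by rw [← dist_eq_norm, dist_comm]; exact hd.1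
  have hdl : |l₁ - l| < ε' := by rw [← Real.dist_eq, dist_comm]; exact hd.2
  set w : E N := Vᗮ.starProjection b₁ with hw
  have hwn : ‖w‖ < ε' := by
    have : w = Vᗮ.starProjection (b₁ - b) := by
      rw [map_sub, Submodule.starProjection_orthogonal_val (K := V) b,
        Submodule.starProjection_eq_self_iff.2 hbV, sub_self, sub_zero]
    rw [this]
    exact (Submodule.norm_starProjection_apply_le _ _).trans_lt hdb
  have hcn : ‖-(κ • w)‖ < δ := by
    rw [norm_neg, norm_smul, Real.norm_of_nonneg hκ0.le]
    calc κ * ‖w‖ ≤ κ * (δ / (2 * κ)) :=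
          mul_le_mul_of_nonneg_left (hwn.le.trans (min_le_right _ _)) hκ0.le
      _ = δ / 2 := by field_simp
      _ < δ := by linarith
  obtain ⟨l₂, h₂⟩ := hnormal (y₀ + v) (by simpa [Metric.mem_ball, dist_eq_norm] using hv3) s hs
    (-(κ • w)) (Vᗮ.neg_mem (Vᗮ.smul_mem _ (Submodule.starProjection_apply_mem _ _))) hcn
  have hl2 := S.abs_le_of_mem_flatBL hM hs h₂
  have hl := S.abs_le_of_mem_flatBL hM ht₀ hbl
  set θ : ℝ := 1 / (1 + κ) with hθ
  have hθ0 : 0 ≤ θ := by positivity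
  have hθκ : 1 - θ = θ * κ := by rw [hθ]; field_simp; ring
  have hθ1 : 0 ≤ 1 - θ := by rw [hθκ]; positivity
  have hθB : θ * B ≤ ε / 2 := by
    rw [hθ, one_div_mul_eq_div, div_le_iff₀ (by positivity), hκ]
    field_simp
    nlinarith
  have hconv := S.convex_flatBL (x := x) hBL (y₀ + v) (Ioc_subset_Icc_self hs) h₁ h₂ hθ1 hθ0 (by ring)
  have hε'2 : ε' ≤ ε / 2 := min_le_left _ _
  refine ⟨(1 - θ) • b₁ + θ • -(κ • w), ?_, (1 - θ) * l₁ + θ * l₂, by simpa using hconv, ?_, ?_⟩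
  · have : (1 - θ) • b₁ + θ • -(κ • w) = (1 - θ) • (b₁ - w) := by
      rw [smul_neg, smul_smul, ← hθκ, smul_sub]
      exact (sub_eq_add_neg _ _).symm
    rw [this, hw, Submodule.starProjection_orthogonal_val, sub_sub_cancel]
    exact V.smul_mem _ (Submodule.starProjection_apply_mem _ _)
  · have : (1 - θ) • b₁ + θ • -(κ • w) - b = (1 - θ) • (b₁ - b) + θ • (-(κ • w) - b) := by
      module
    rw [this]
    refine (norm_add_le _ _).trans ?_
    rw [norm_smul, norm_smul, Real.norm_of_nonneg hθ0, Real.norm_of_nonneg hθ1]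
    have h3 : ‖-(κ • w) - b‖ ≤ B := (norm_sub_le _ _).trans (by linarith)
    have h4 : θ * ‖-(κ • w) - b‖ ≤ θ * B := mul_le_mul_of_nonneg_left h3 hθ0
    nlinarith [norm_nonneg (b₁ - b)]
  · have : (1 - θ) * l₁ + θ * l₂ - l = (1 - θ) * (l₁ - l) + θ * (l₂ - l) := by ring
    rw [this]
    refine (abs_add_le _ _).trans ?_
    rw [abs_mul, abs_mul, abs_of_nonneg hθ0, abs_of_nonneg hθ1]
    have h3 : |l₂ - l| ≤ B := by
      have := abs_sub l₂ l
      linarith [norm_nonneg b]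
    have h4 : θ * |l₂ - l| ≤ θ * B := mul_le_mul_of_nonneg_left h3 hθ0
    nlinarith [abs_nonneg (l₁ - l)]

/-- Starting on the stratum, one can follow it for a short time with a velocity and a running cost
close to a prescribed tangential element of the dynamics. -/
lemma exists_tangential_value_le (hBL : IsBL T BL) (hg : ∃ C, ∀ x, |g x| ≤ C)
    {V : Submodule ℝ (E N)} {η : ℝ} {K : NNReal}
    (hηt : Metric.closedBall (S.Ψ x x) η ⊆ (S.Ψ x).target)
    (hK : LipschitzOnWith K (S.Ψ x).symm (Metric.closedBall (S.Ψ x x) η))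
    {t₀ : ℝ} {b : E N} {l ε : ℝ} (hbV : b ∈ V) (hε : 0 < ε)
    (hlsc : ∀ v ∈ V, ‖v‖ ≤ η → ∀ s ∈ Ioc 0 T, |s - t₀| ≤ η →
      ∃ b' ∈ V, ∃ l', (b', l') ∈ S.flatBL x BL (S.Ψ x x + v, s) ∧ ‖b' - b‖ ≤ ε ∧ |l' - l| ≤ ε)
    {v : E N} (hv : v ∈ V) (hvη : ‖v‖ ≤ η / 2) {t h : ℝ} (htT : t ≤ T) (htη : |t - t₀| ≤ η / 2)
    (h0 : 0 < h) (hht : h ≤ t) (hhη : h ≤ η / 2) (hhb : h * (‖b‖ + ε) ≤ η / 2) :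
    ∃ u ∈ V, ‖u - b‖ ≤ ε ∧ value BL g ((S.Ψ x).symm (S.Ψ x x + v), t) ≤
      (l + ε) * h + value BL g ((S.Ψ x).symm (S.Ψ x x + (v + h • u)), t - h) := by
  set y₀ := S.Ψ x x
  have hspeed : ∀ c ∈ Metric.closedBall (((⟨b, hbV⟩ : V), l) : V × ℝ) ε, ‖c.1‖ ≤ ‖b‖ + ε :=
    fun c hc => by
      rw [mem_closedBall_iff_norm, Prod.norm_def, max_le_iff] at hc
      have h1 : ‖(c.1 : E N) - b‖ ≤ ε := hc.1
      have h2 : ‖(c.1 : E N)‖ ≤ ‖b‖ + ‖(c.1 : E N) - b‖ := norm_le_insert' _ _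
      exact h2.trans (by linarith)
  have hKball : ∀ s ∈ Icc 0 h, ∀ c ∈ Metric.closedBall (((⟨b, hbV⟩ : V), l) : V × ℝ) ε,
      ‖(⟨v, hv⟩ : V) + s • c.1‖ ≤ η := fun s hs c hc => by
    refine (norm_add_le _ _).trans ?_
    rw [norm_smul, Real.norm_of_nonneg hs.1]
    have h1 : ‖(⟨v, hv⟩ : V)‖ ≤ η / 2 := hvη
    have h2 : s * ‖c.1‖ ≤ h * (‖b‖ + ε) := mul_le_mul hs.2 (hspeed c hc) (norm_nonneg _) h0.le
    linarith
  have htime : ∀ s ∈ Icc 0 h, |t - s - t₀| ≤ η := fun s hs => by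
    have := abs_le.1 htη
    rw [abs_le]
    constructor <;> linarith [hs.1, hs.2]
  obtain ⟨Z, hZ0, hZ, hZd⟩ := exists_solution (W := V × ℝ) (w₀ := (⟨v, hv⟩, 0))
    (C := Metric.closedBall (⟨b, hbV⟩, l) ε) (K := {w | ‖w.1‖ ≤ η})
    (F := fun w s => {c | ((c.1 : E N), c.2) ∈ S.flatBL x BL (y₀ + w.1, t - s)}) h0
    (isCompact_closedBall _ _) (convex_closedBall _ _) ⟨_, Metric.mem_closedBall_self hε.le⟩
    (fun s hs c hc => hKball s hs c hc)
    (fun w hw s hs => by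
      obtain ⟨b', hb', l', hbl', h1, h2⟩ := hlsc w.1 w.1.2 hw (t - s)
        ⟨by linarith [hs.2], by linarith [hs.1]⟩ (htime s (Ico_subset_Icc_self hs))
      refine ⟨(⟨b', hb'⟩, l'), hbl', ?_⟩
      rw [mem_closedBall_iff_norm, Prod.norm_def]
      exact max_le h1 h2)
    (fun w hw s hs c₁ h₁ c₂ h₂ α β hα hβ hαβ => by
      have hts : t - s ∈ Icc 0 T := ⟨by linarith [hs.2], by linarith [hs.1]⟩
      have := S.convex_flatBL (x := x) hBL (y₀ + w.1) hts h₁ h₂ hα hβ hαβ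
      simpa using this)
    (by
      have hcl := S.isClosed_graph_flatBL (x := x) hBL Metric.isClosed_closedBall hηt
      convert! ((isClosed_le (f := fun p : (V × ℝ) × ℝ × (V × ℝ) => ‖p.1.1‖) (g := fun _ => η)
        (by fun_prop) (by fun_prop)).inter
        (isClosed_Icc.preimage (t := Icc 0 h) (f := fun p : (V × ℝ) × ℝ × (V × ℝ) => p.2.1)
        (by fun_prop))).inter (hcl.preimage
          (f := fun p : (V × ℝ) × ℝ × (V × ℝ) => ((y₀ + (p.1.1 : E N), t - p.2.1),
            ((p.2.2.1 : E N), p.2.2.2))) (by fun_prop)) using 1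
      ext ⟨w, s, c⟩
      simp only [mem_inter_iff, mem_ofPred_eq, mem_preimage]
      constructor
      · rintro ⟨h1, h2, h3⟩
        refine ⟨⟨h1, h2⟩, ?_, ⟨by linarith [h2.2], by linarith [h2.1]⟩, h3⟩
        rw [mem_closedBall_iff_norm, add_sub_cancel_left]
        exact h1
      · rintro ⟨⟨h1, h2⟩, -, -, h3⟩
        exact ⟨h1, h2, h3⟩)
  have hCb : ∀ c ∈ Metric.closedBall (((⟨b, hbV⟩ : V), l) : V × ℝ) ε,
      ‖c‖ ≤ ‖(((⟨b, hbV⟩ : V), l) : V × ℝ)‖ + ε := fun c hc =>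
    norm_le_norm_add_const_of_dist_le hc
  obtain ⟨K', hlip⟩ : ∃ K', LipschitzOnWith K' Z (Icc 0 h) :=
    ⟨_, lipschitzOnWith_Icc_of_increment hCb hZ⟩
  have hYlip : LipschitzOnWith (1 * K') (fun s => y₀ + ((Z s).1 : E N)) (Icc 0 h) := by
    have : LipschitzWith 1 fun w : V × ℝ => y₀ + (w.1 : E N) := LipschitzWith.mk_one fun p q => by
      rw [dist_add_left]
      exact le_max_left _ _
    exact this.comp_lipschitzOnWith hlip
  have hmaps : MapsTo (fun s => y₀ + ((Z s).1 : E N)) (Icc 0 h) (Metric.closedBall y₀ η) :=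
    fun s hs => by
      obtain ⟨c, hc, hcz⟩ := hZ 0 ⟨le_rfl, h0.le⟩ s hs hs.1
      rw [hZ0, sub_eq_iff_eq_add', sub_zero] at hcz
      rw [mem_closedBall_iff_norm, add_sub_cancel_left, hcz]
      exact hKball s hs c hc
  have harc := S.isArc_of_flat (BL := BL) (t := t) hηt hK hYlip
    (LipschitzWith.prod_snd.comp_lipschitzOnWith hlip) (by simp [hZ0]) hmaps (by
      filter_upwards [hZd] with s ⟨c, hc, hd⟩
      exact ⟨c.1, c.2, hc, (V.subtypeL.hasFDerivAt.comp_hasDerivAt s hd.fst).const_add y₀, hd.snd⟩)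
  obtain ⟨c, hc, hcz⟩ := hZ 0 ⟨le_rfl, h0.le⟩ h ⟨h0.le, le_rfl⟩ h0.le
  rw [hZ0, sub_eq_iff_eq_add', sub_zero] at hcz
  have hcost : ∀ᵐ s ∂(volume.restrict (Ioo 0 h)), deriv (fun s => (Z s).2) s ≤ l + ε := by
    filter_upwards [hZd, ae_restrict_mem measurableSet_Ioo] with s ⟨d, _, hd⟩ hs
    have hd₂ : HasDerivAt (fun s => (Z s).2) d.2 s := hd.snd
    rw [hd₂.deriv]
    -- the derivative is a limit of difference quotients, which lie in the ball of
    -- radius `ε` around `(b, l)`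
    have hslope := hd.tendsto_slope_zero_right
    have hball : d ∈ Metric.closedBall (((⟨b, hbV⟩ : V), l) : V × ℝ) ε := by
      refine Metric.isClosed_closedBall.mem_of_tendsto hslope ?_
      filter_upwards [Ioo_mem_nhdsGT (sub_pos.2 hs.2)] with q hq
      obtain ⟨c, hc, hcz⟩ := hZ s (Ioo_subset_Icc_self hs) (s + q)
        ⟨by linarith [hs.1, hq.1], by linarith [hq.2]⟩ (by linarith [hq.1])
      rw [hcz, add_sub_cancel_left, smul_smul, inv_mul_cancel₀ hq.1.ne', one_smul]
      exact hc
    rw [mem_closedBall_iff_norm, Prod.norm_def, max_le_iff] at hball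
    have : |d.2 - l| ≤ ε := hball.2
    linarith [(abs_le.1 this).2]
  have hval := harc.value_le (g := g) hBL hg h0.le hht htT hcost
  rw [mem_closedBall_iff_norm, Prod.norm_def, max_le_iff] at hc
  refine ⟨c.1, c.1.2, hc.1, ?_⟩
  simpa [hZ0, hcz] using hval

end Tangential

/-! ### The subsolution property -/

section Subsolution

variable {N : ℕ} {T : ℝ} {BL : E N × ℝ → Set (E N × ℝ)} {S : RegularStratification N} {x : E N}
  {g : E N → ℝ}

/-- Near a point `(x, t)` of the stratum, a tangential element `(b, l)` of the dynamics can be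
followed along the stratum, up to an error `ε`, for every short duration `h`. The starting points
allowed depend on `h`. -/
lemma eventually_tangential_value_le (hBL : IsBL T BL) (hgb : ∃ C, ∀ x, |g x| ≤ C)
    (hTC : TangentialContinuity T BL S) (hNC : NormalControllability T BL S) {k : Fin (N + 1)}
    (hk : (k : ℕ) < N) (hx : x ∈ S.M k) {t : ℝ} (ht : t ∈ Ioo 0 T) {b : E N} {l : ℝ}
    (hbl : (b, l) ∈ BL (x, t)) (hb : b ∈ tangentSpaceAt (S.M k) x) {ε : ℝ} (hε : 0 < ε) :
    ∀ᶠ h in 𝓝[>] (0 : ℝ), ∀ᶠ z in 𝓝[S.M k ×ˢ Icc (0 : ℝ) T] (x, t),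
      ∃ u, ‖u - fderiv ℝ (S.Ψ x) x b‖ ≤ ε ∧ (S.Ψ x).symm (S.Ψ x z.1 + h • u) ∈ S.M k ∧
        value BL g z ≤
          (l + ε) * h + value BL g ((S.Ψ x).symm (S.Ψ x z.1 + h • u), z.2 - h) := by
  obtain ⟨M, hM0, hM⟩ := hBL.bounded
  have htT : t ∈ Ioc 0 T := Ioo_subset_Ioc_self ht
  set y₀ := S.Ψ x x
  have hxs := S.mem_source x
  have hχ₀ : (S.Ψ x).symm y₀ = x := (S.Ψ x).left_inv hxs
  obtain ⟨r₁, V, hflat₁, δ, hδ, hδNC⟩ := hNC k hk x hx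
  obtain ⟨r₂, V₂, hflat₂, _, m, -, hm, hmTC⟩ := hTC k x hx
  obtain rfl := hflat₁.subspace_unique hflat₂
  obtain ⟨ρ₀, hρ₀, K, hρt, hK⟩ := S.exists_lipschitzOnWith_symm x
  have hr₁ := hflat₁.pos
  set ρ := min ρ₀ r₁
  have hρ : 0 < ρ := by positivity
  have hsub : Metric.closedBall y₀ ρ ⊆ Metric.closedBall y₀ ρ₀ :=
    Metric.closedBall_subset_closedBall (min_le_left _ _)
  set b' : E N := fderiv ℝ (S.Ψ x) x b with hb'
  have hb'V : b' ∈ V := S.fderiv_chart_mem hflat₁ hb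
  have hbl' : (b', l) ∈ S.flatBL x BL (y₀, t) := by
    refine ⟨(b, l), ?_, ?_⟩
    · simpa only [hχ₀] using hbl
    · simp only [hχ₀, hb']
  obtain ⟨η₁, hη₁, hlsc⟩ := exists_tangential_near hBL hM0 hM hflat₂ hδ hρ
    (fun y hy t ht c hcV hcδ => exists_mem_flatBL_orthogonal hBL hM hk hflat₁ hδNC
      (min_le_right _ _) (hsub.trans hρt) hy ht hcV hcδ) hm
    (fun y₁ h₁ y₂ h₂ h s hs s' hs' => (hmTC k le_rfl y₁ h₁ y₂ h₂ h s hs).2 s' hs') htT hb'V hbl' hε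
  set η : ℝ := min (η₁ / 2) (min (ρ / 2) t)
  have ht0 : 0 < t := ht.1
  have hη0 : 0 < η := by positivity
  have hηη₁ : η ≤ η₁ / 2 := min_le_left _ _
  have hηρ : η ≤ ρ / 2 := (min_le_right _ _).trans (min_le_left _ _)
  have hηt : η ≤ t := (min_le_right _ _).trans (min_le_right _ _)
  have hηr : η < r₁ := by linarith [min_le_right ρ₀ r₁]
  have hηball : Metric.closedBall y₀ η ⊆ Metric.closedBall y₀ ρ :=
    Metric.closedBall_subset_closedBall (by linarith)
  have hhpos : 0 < min (η / 2) (η / 2 / (‖b'‖ + ε)) := by positivity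
  filter_upwards [Ioo_mem_nhdsGT hhpos] with h ⟨hh0, hhlt⟩
  have hhη : h < η / 2 := hhlt.trans_le (min_le_left _ _)
  have hhb : h * (‖b'‖ + ε) < η / 2 := by
    rw [← lt_div_iff₀ (by positivity)]
    exact hhlt.trans_le (min_le_right _ _)
  have hv : ∀ᶠ z : E N × ℝ in 𝓝 (x, t), ‖S.Ψ x z.1 - y₀‖ < η / 2 := by
    have := ((S.Ψ x).continuousAt hxs).tendsto.comp (continuous_fst.tendsto (x, t))
    simpa [dist_eq_norm] using this.eventually (Metric.ball_mem_nhds _ (half_pos hη0))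
  have ht' : ∀ᶠ z : E N × ℝ in 𝓝 (x, t), |z.2 - t| < η / 2 := by
    simpa [Real.dist_eq] using
      (continuous_snd.tendsto (x, t)).eventually (Metric.ball_mem_nhds _ (half_pos hη0))
  have hsrc : ∀ᶠ z : E N × ℝ in 𝓝 (x, t), z.1 ∈ (S.Ψ x).source :=
    (continuous_fst.tendsto (x, t)).eventually ((S.Ψ x).open_source.mem_nhds hxs)
  filter_upwards [nhdsWithin_le_nhds hv, nhdsWithin_le_nhds ht', nhdsWithin_le_nhds hsrc,
    self_mem_nhdsWithin] with ⟨x', t'⟩ (hv : ‖S.Ψ x x' - y₀‖ < η / 2) (ht' : |t' - t| < η / 2)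
    (hsrc : x' ∈ (S.Ψ x).source) ⟨hx', htx'⟩
  have hyv : S.Ψ x x' = y₀ + (S.Ψ x x' - y₀) := by abel
  have hvV : S.Ψ x x' - y₀ ∈ V := (hflat₁.mem_iff (by
    rw [mem_ball_iff_norm]
    linarith)).1 (S.mem_flatM hx' hsrc)
  obtain ⟨u, huV, hub, hle⟩ := exists_tangential_value_le (g := g) (t := t') (h := h) hBL hgb
    (hηball.trans (hsub.trans hρt)) (hK.mono (hηball.trans hsub)) hb'V hε
    (fun v hv hvη s hs hsη => hlsc v hv (by linarith) s hs (by linarith)) hvV hv.le htx'.2 ht'.le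
    hh0 (by linarith [(abs_lt.1 ht').1]) hhη.le hhb.le
  rw [← add_assoc, ← hyv, (S.Ψ x).left_inv hsrc] at hle
  refine ⟨u, hub, ?_, hle⟩
  have hun : ‖u‖ ≤ ‖b'‖ + ε := by
    have : ‖u‖ ≤ ‖b'‖ + ‖u - b'‖ := norm_le_insert' _ _
    linarith
  have hsum : S.Ψ x x' + h • u - y₀ = (S.Ψ x x' - y₀) + h • u := by abel
  have hb : S.Ψ x x' + h • u ∈ Metric.ball y₀ r₁ := by
    rw [mem_ball_iff_norm, hsum]
    refine (norm_add_le _ _).trans_lt ?_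
    rw [norm_smul, Real.norm_of_nonneg hh0.le]
    have := mul_le_mul_of_nonneg_left hun hh0.le
    linarith
  refine S.symm_mem_stratum ((hflat₁.mem_iff hb).2 ?_)
  rw [hsum]
  exact V.add_mem hvV (V.smul_mem _ huV)

lemma exists_hasStrictFDerivAt_flat {t : ℝ} {φ : E N × ℝ → ℝ} (hφ : ContDiffAt ℝ 1 φ (x, t))
    (b : E N) :
    ∃ Λ : E N × ℝ →L[ℝ] ℝ,
      HasStrictFDerivAt (fun z : E N × ℝ => φ ((S.Ψ x).symm z.1, z.2)) Λ (S.Ψ x x, t) ∧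
      Λ (fderiv ℝ (S.Ψ x) x b, -1) = fderiv ℝ φ (x, t) (b, -1) := by
  have hy₀t : S.Ψ x x ∈ (S.Ψ x).target := (S.Ψ x).map_source (S.mem_source x)
  have hχ₀ : (S.Ψ x).symm (S.Ψ x x) = x := (S.Ψ x).left_inv (S.mem_source x)
  have h1 : HasStrictFDerivAt φ (fderiv ℝ φ (x, t)) ((S.Ψ x).symm (S.Ψ x x), t) := by
    rw [hχ₀]
    exact hφ.hasStrictFDerivAt one_ne_zero
  have h2 : HasStrictFDerivAt (fun z : E N × ℝ => (S.Ψ x).symm z.1)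
      ((fderiv ℝ (S.Ψ x).symm (S.Ψ x x)).comp (ContinuousLinearMap.fst ℝ (E N) ℝ))
      (S.Ψ x x, t) :=
    (S.hasStrictFDerivAt_symm hy₀t).comp (S.Ψ x x, t) hasStrictFDerivAt_fst
  refine ⟨_, h1.comp (S.Ψ x x, t) (h2.prodMk hasStrictFDerivAt_snd), ?_⟩
  have h3 := S.fderiv_symm_fderiv_chart hy₀t b
  rw [hχ₀] at h3
  simp [h3]

/-- A first-order upper bound for the increment `(h u, - h)`, with `u` close to `b`. -/
lemma increment_le {Φ : E N × ℝ → ℝ} {Λ : E N × ℝ →L[ℝ] ℝ} {z z' : E N × ℝ} {u b : E N}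
    {h ε : ℝ} (hh : 0 < h) (hε0 : 0 < ε) (hε1 : ε ≤ 1) (hub : ‖u - b‖ ≤ ε)
    (hz : z' - z = h • (u, (-1 : ℝ))) (hΦ : ‖Φ z' - Φ z - Λ (z' - z)‖ ≤ ε * ‖z' - z‖) :
    Φ z' ≤ Φ z + h * (Λ (b, -1) + ε * (2 + ‖Λ‖ + ‖b‖)) := by
  simp only [hz, map_smul, norm_smul, Real.norm_of_nonneg hh.le, smul_eq_mul] at hΦ
  have hun : ‖u‖ ≤ ‖b‖ + ‖u - b‖ := norm_le_insert' _ _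
  have h1 : ‖(u, (-1 : ℝ))‖ ≤ 2 + ‖b‖ := by
    rw [Prod.norm_def]
    refine max_le ?_ ?_
    · simp only; linarith
    · simp only [norm_neg, norm_one]; linarith [norm_nonneg b]
  have h2 : Λ (u, -1) ≤ Λ (b, -1) + ‖Λ‖ * ε := by
    have : Λ (u, -1) = Λ (b, -1) + Λ (u - b, 0) := by
      rw [← map_add]; simp
    rw [this]
    have h3 := (le_abs_self _).trans (Λ.le_opNorm (u - b, 0))
    have h4 : ‖(u - b, (0 : ℝ))‖ ≤ ε := by
      rw [Prod.norm_def]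
      exact max_le hub (by simpa using hε0.le)
    have := mul_le_mul_of_nonneg_left h4 (norm_nonneg Λ)
    linarith
  have h5 := (le_abs_self _).trans hΦ
  have h6 := mul_le_mul_of_nonneg_left h1 (mul_nonneg hε0.le hh.le)
  have h7 := mul_le_mul_of_nonneg_left h2 hh.le
  linarith

/-- The viscosity inequality for one tangential element `(b, l)` of the dynamics, as
`φ' (b, -1) = Dφ · b - φ_t`. Trajectories start at points of the stratum where the value is close to
its envelope; these starting points tend to `(x, t)` while the duration `h` stays fixed. -/
lemma neg_fderiv_sub_le_zero (hT : 0 < T) (hBL : IsBL T BL) (hgb : ∃ C, ∀ x, |g x| ≤ C)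
    (hg : UniformContinuous g) (hTC : TangentialContinuity T BL S)
    (hNC : NormalControllability T BL S) {k : Fin (N + 1)} (hk : (k : ℕ) < N) (hx : x ∈ S.M k)
    {t : ℝ} (ht : t ∈ Ioo 0 T) {φ : E N × ℝ → ℝ} (hφ : ContDiffAt ℝ 1 φ (x, t))
    (hmax : IsLocalMaxOn
      (fun z => uscEnvelope (univ ×ˢ Icc 0 T) (value BL g) z - φ z) (S.M k ×ˢ Ioo 0 T) (x, t))
    {b : E N} {l : ℝ} (hbl : (b, l) ∈ BL (x, t)) (hb : b ∈ tangentSpaceAt (S.M k) x) :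
    -fderiv ℝ φ (x, t) (b, -1) - l ≤ 0 := by
  by_contra! hcon
  obtain ⟨C, hC⟩ := exists_abs_value_le (g := g) hBL hgb
  have hCD : ∀ z ∈ (univ : Set (E N)) ×ˢ Icc (0 : ℝ) T, |value BL g z| ≤ C := fun z hz => hC z hz.2
  have hCk : ∀ z ∈ S.M k ×ˢ Icc (0 : ℝ) T, |value BL g z| ≤ C := fun z hz => hC z hz.2
  have hxs := S.mem_source x
  have hy₀t : S.Ψ x x ∈ (S.Ψ x).target := (S.Ψ x).map_source hxs
  have hχ₀ : (S.Ψ x).symm (S.Ψ x x) = x := (S.Ψ x).left_inv hxs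
  obtain ⟨Λ, hΛ, hΛb⟩ := exists_hasStrictFDerivAt_flat (S := S) hφ b
  set Φ : E N × ℝ → ℝ := fun z => φ ((S.Ψ x).symm z.1, z.2) with hΦ
  set b' : E N := fderiv ℝ (S.Ψ x) x b
  set a : ℝ := -fderiv ℝ φ (x, t) (b, -1) - l with ha
  -- `ε` bounds all the relative errors, whose total is at most `a / 2`
  set Q : ℝ := 3 + ‖Λ‖ + ‖b'‖ with hQ
  have hQ0 : 0 < Q := by positivity
  set ε : ℝ := min 1 (a / (2 * Q))
  have hε0 : 0 < ε := by positivity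
  have hε1 : ε ≤ 1 := min_le_left _ _
  have hεa : ε * Q ≤ a / 2 := by
    have : ε ≤ a / (2 * Q) := min_le_right _ _
    rw [le_div_iff₀ (by positivity)] at this
    linarith
  have hstrict : ∀ᶠ p : (E N × ℝ) × (E N × ℝ) in 𝓝 ((S.Ψ x x, t), (S.Ψ x x, t)),
      ‖Φ p.1 - Φ p.2 - Λ (p.1 - p.2)‖ ≤ ε * ‖p.1 - p.2‖ := hΛ.isLittleO.def hε0
  have hmax' : ∀ᶠ z in 𝓝 (S.Ψ x x, t), (S.Ψ x).symm z.1 ∈ S.M k → z.2 ∈ Ioo 0 T ∧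
      uscEnvelope (univ ×ˢ Icc 0 T) (value BL g) ((S.Ψ x).symm z.1, z.2) - Φ z ≤
        uscEnvelope (univ ×ˢ Icc 0 T) (value BL g) (x, t) - φ (x, t) := by
    have h1 : Tendsto (fun z : E N × ℝ => ((S.Ψ x).symm z.1, z.2)) (𝓝 (S.Ψ x x, t))
        (𝓝 (x, t)) := by
      have h2 := ((S.Ψ x).symm.continuousAt hy₀t).tendsto.comp
        (continuous_fst.tendsto (S.Ψ x x, t))
      rw [hχ₀] at h2
      exact h2.prodMk_nhds (continuous_snd.tendsto (S.Ψ x x, t))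
    filter_upwards [h1.eventually (eventually_nhdsWithin_iff.1 hmax),
      (continuous_snd.tendsto (S.Ψ x x, t)).eventually (Ioo_mem_nhds ht.1 ht.2)] with z hz h4 h3
    exact ⟨h4, hz ⟨h3, h4⟩⟩
  -- the end point `(Ψ x' + h u, t' - h)` of the arcs considered, as a function of `(x', t')` and
  -- `(h, u)`, stays near `(Ψ x, t)`
  obtain ⟨σ₁, hσ₁, hstrict⟩ := Metric.eventually_nhds_iff.1 hstrict
  obtain ⟨σ₂, hσ₂, hmax'⟩ := Metric.eventually_nhds_iff.1 hmax'
  set σ : ℝ := min σ₁ σ₂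
  have hσ : 0 < σ := lt_min hσ₁ hσ₂
  have hhpos : 0 < σ / 2 / (‖b'‖ + 1) := by positivity
  obtain ⟨h, hmove, hh0, hhσ⟩ := ((eventually_tangential_value_le hBL hgb hTC hNC hk hx ht hbl hb
    hε0).and (Ioo_mem_nhdsGT hhpos)).exists
  rw [lt_div_iff₀ (by positivity)] at hhσ
  have hΨ : Tendsto (fun z : E N × ℝ => (S.Ψ x z.1, z.2)) (𝓝 (x, t)) (𝓝 (S.Ψ x x, t)) :=
    (((S.Ψ x).continuousAt hxs).tendsto.comp (continuous_fst.tendsto (x, t))).prodMk_nhds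
      (continuous_snd.tendsto (x, t))
  have hnear : ∀ᶠ z : E N × ℝ in 𝓝 (x, t), dist (S.Ψ x z.1, z.2) (S.Ψ x x, t) < σ / 2 :=
    hΨ.eventually (Metric.ball_mem_nhds _ (half_pos hσ))
  have hha : 0 < h * a / 8 := div_pos (mul_pos hh0 hcon) (by norm_num)
  have hΦnear : ∀ᶠ z : E N × ℝ in 𝓝 (x, t), Φ (S.Ψ x z.1, z.2) < φ (x, t) + h * a / 8 := by
    have := hΛ.hasFDerivAt.continuousAt.tendsto.comp hΨ
    have hΦ₀ : Φ (S.Ψ x x, t) = φ (x, t) := by simp only [hΦ, hχ₀]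
    rw [hΦ₀] at this
    exact this.eventually_lt_const (by linarith)
  have hxk : (x, t) ∈ S.M k ×ˢ Icc (0 : ℝ) T := ⟨hx, Ioo_subset_Icc_self ht⟩
  have hfreq : ∃ᶠ z in 𝓝[S.M k ×ˢ Icc (0 : ℝ) T] (x, t),
      uscEnvelope (univ ×ˢ Icc 0 T) (value BL g) (x, t) - h * a / 8 < value BL g z := by
    rw [uscEnvelope_value_eq hT hBL hgb hg hNC hk hxk]
    exact frequently_lt_of_lt_limsup (isCoboundedUnder_le_of_bound hCk hxk) (sub_lt_self _ hha)
  obtain ⟨z, hval, ⟨hz1, hz2⟩, u, hub, hend, hle⟩ := (hfreq.and_eventually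
    (((hnear.and hΦnear).filter_mono nhdsWithin_le_nhds).and hmove)).exists
  set ζ : E N × ℝ := (S.Ψ x z.1, z.2)
  set ζ' : E N × ℝ := (S.Ψ x z.1 + h • u, z.2 - h)
  have hdiff : ζ' - ζ = h • (u, (-1 : ℝ)) := by
    ext1 <;> simp [ζ, ζ', sub_eq_add_neg]
  have hdist : dist ζ' ζ < σ / 2 := by
    rw [dist_eq_norm, hdiff, norm_smul, Real.norm_of_nonneg hh0.le]
    have hun : ‖u‖ ≤ ‖b'‖ + ‖u - b'‖ := norm_le_insert' _ _
    have : ‖(u, (-1 : ℝ))‖ ≤ ‖b'‖ + 1 := by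
      rw [Prod.norm_def]
      refine max_le ?_ ?_
      · simp only; linarith
      · simp only [norm_neg, norm_one]; linarith [norm_nonneg b']
    have := mul_le_mul_of_nonneg_left this hh0.le
    linarith
  have hdist' : dist ζ' (S.Ψ x x, t) < σ := by
    linarith [dist_triangle ζ' ζ (S.Ψ x x, t)]
  obtain ⟨htend, h1⟩ := hmax' (y := ζ') (hdist'.trans_le (min_le_right _ _)) hend
  have h2 : value BL g ((S.Ψ x).symm ζ'.1, ζ'.2) ≤
      uscEnvelope (univ ×ˢ Icc 0 T) (value BL g) ((S.Ψ x).symm ζ'.1, ζ'.2) :=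
    le_uscEnvelope hCD ⟨mem_univ _, Ioo_subset_Icc_self htend⟩
  have h3 := increment_le hh0 hε0 hε1 hub hdiff (hstrict (y := (ζ', ζ)) (by
    rw [Prod.dist_eq]
    exact (max_lt hdist' (by linarith)).trans_le (min_le_left _ _)))
  have h4 : ε * (2 + ‖Λ‖ + ‖b'‖) + ε ≤ a / 2 := by
    have : ε * Q = ε * (2 + ‖Λ‖ + ‖b'‖) + ε := by rw [hQ]; ring
    linarith
  have h5 := mul_le_mul_of_nonneg_left h4 hh0.le
  have h6 : h * a = -(h * Λ (b', -1)) - h * l := by rw [ha, hΛb]; ring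
  have h7 : value BL g z ≤ (l + ε) * h + value BL g ((S.Ψ x).symm ζ'.1, ζ'.2) := hle
  linarith

/-- At a point of a stratum `M k` with `k < N` the null velocity is admissible, hence the supremum
defining the tangential Hamiltonian is taken over a nonempty set. -/
lemma exists_zero_mem (hBL : IsBL T BL) (hNC : NormalControllability T BL S) {k : Fin (N + 1)}
    (hk : (k : ℕ) < N) (hx : x ∈ S.M k) {t : ℝ} (ht : t ∈ Ioc 0 T) : ∃ l, (0, l) ∈ BL (x, t) := by
  obtain ⟨M, hM0, hM⟩ := hBL.bounded
  obtain ⟨r, V, hflat, δ, hδ, hδNC⟩ := hNC k hk x hx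
  obtain ⟨ρ₀, hρ₀, K, hρt, -⟩ := S.exists_lipschitzOnWith_symm x
  have hr := hflat.pos
  obtain ⟨l, hl⟩ := exists_mem_flatBL_orthogonal (ρ := min ρ₀ r) hBL hM hk hflat hδNC
    (min_le_right _ _) ((Metric.closedBall_subset_closedBall (min_le_left _ _)).trans hρt)
    (Metric.mem_ball_self (by positivity)) ht Vᗮ.zero_mem (by simpa using hδ)
  refine ⟨l, ?_⟩
  have := (S.mem_flatBL ((S.Ψ x).map_source (S.mem_source x))).1 hl
  rwa [map_zero, (S.Ψ x).left_inv (S.mem_source x)] at this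

lemma isSubsolutionOnStratum_value (hT : 0 < T) (hBL : IsBL T BL) (hgb : ∃ C, ∀ x, |g x| ≤ C)
    (hg : UniformContinuous g) (hTC : TangentialContinuity T BL S)
    (hNC : NormalControllability T BL S) {k : Fin (N + 1)} (hk : (k : ℕ) < N) :
    IsSubsolutionOnStratum T BL (S.M k) (value BL g) where
  locallyBounded z hz := by
    obtain ⟨C, hC⟩ := exists_abs_value_le (g := g) hBL hgb
    exact ⟨C, eventually_nhdsWithin_of_forall fun z hz => hC z hz.2⟩
  subsolution φ x t hx ht hφ hmax := by
    have hd : HasFDerivAt φ (fderiv ℝ φ (x, t)) (x, t) :=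
      (hφ.differentiableAt one_ne_zero).hasFDerivAt
    have h1 : deriv (fun s => φ (x, s)) t = fderiv ℝ φ (x, t) (0, 1) := by
      have : HasDerivAt (fun s : ℝ => ((x, s) : E N × ℝ)) (0, 1) t :=
        (hasDerivAt_const t x).prodMk (hasDerivAt_id t)
      exact (hd.comp_hasDerivAt t this).deriv
    have h2 : ∀ b, inner ℝ b (gradient (fun y => φ (y, t)) x) = fderiv ℝ φ (x, t) (b, 0) := by
      intro b
      have : HasFDerivAt (fun y : E N => φ (y, t))
          ((fderiv ℝ φ (x, t)).comp (ContinuousLinearMap.inl ℝ (E N) ℝ)) x :=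
        hd.comp x (hasFDerivAt_prodMk_left x t)
      rw [real_inner_comm, gradient, InnerProductSpace.toDual_symm_apply, this.fderiv]
      rfl
    rw [← le_neg_iff_add_nonpos_left]
    refine csSup_le ?_ ?_
    · obtain ⟨l, hl⟩ := exists_zero_mem hBL hNC hk hx (Ioo_subset_Ioc_self ht)
      exact ⟨_, (0, l), ⟨hl, fun _ => x, by simpa using hx, rfl, hasDerivAt_const 0 x⟩, rfl⟩
    · rintro _ ⟨⟨b, l⟩, ⟨hbl, hb⟩, rfl⟩
      have := neg_fderiv_sub_le_zero hT hBL hgb hg hTC hNC hk hx ht hφ hmax hbl hb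
      have h3 : fderiv ℝ φ (x, t) (b, -1) = fderiv ℝ φ (x, t) (b, 0) - fderiv ℝ φ (x, t) (0, 1) := by
        rw [← map_sub]; simp
      simp only [h1, h2]
      linarith

end Subsolution

end StratifiedControl

theorem theorem4p1 {N : ℕ} {T : ℝ} (hT : 0 < T)
    (BL : StratifiedControl.E N × ℝ → Set (StratifiedControl.E N × ℝ))
    (hBL : StratifiedControl.IsBL T BL)
    (g : StratifiedControl.E N → ℝ) (hg_bdd : ∃ C, ∀ x, |g x| ≤ C) (hg : UniformContinuous g)
    (S : StratifiedControl.RegularStratification N)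
    (hTC : StratifiedControl.TangentialContinuity T BL S)
    (hNC : StratifiedControl.NormalControllability T BL S) :
    (∀ k : Fin (N + 1), (k : ℕ) < N → ∀ z ∈ S.M k ×ˢ Icc (0 : ℝ) T,
      StratifiedControl.uscEnvelope (univ ×ˢ Icc (0 : ℝ) T) (StratifiedControl.value BL g) z =
        StratifiedControl.uscEnvelope (S.M k ×ˢ Icc (0 : ℝ) T)
          (StratifiedControl.value BL g) z) ∧
    (∀ k : Fin (N + 1), (k : ℕ) < N →
      StratifiedControl.IsSubsolutionOnStratum T BL (S.M k) (StratifiedControl.value BL g)) := by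
  exact ⟨fun k hk z hz => StratifiedControl.uscEnvelope_value_eq hT hBL hg_bdd hg hNC hk hz,
    fun k hk => StratifiedControl.isSubsolutionOnStratum_value hT hBL hg_bdd hg hTC hNC hk⟩
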